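/- For $r\in\mathbb C$ consider the cubic map $f_r(x)=rx-x^3$ on $\mathbb C$. An $n$-cycle of $f_r$ is the orbit $\{x_1,\dots,x_n\}$ of a point whose minimal period is exactly $n$; its multiplier is $\Lambda=\prod_{k=1}^n f_r'(x_k)=\prod_{k=1}^n(r-3x_k^2)$. For $n\ge 1$ put $$L_e(n)=\frac1n\sum_{cd=n}\mu(c)\Bigl[1+\mathrm{odd}(c)\,\frac{3^d-1}{2}\Bigr],\qquad \mathrm{odd}(c)=\frac{1-(-1)^c}{2},$$ where the sum is over all pairs of positive integers $c,d$ with $cd=n$ and $\mu$ is the Möbius function. Let the minimal polynomial of the $n$-cycles be the polynomial $P_n(r,\lambda)\in\mathbb C[r][\lambda]$, monic in $\lambda$, such that $P_n(r,\Lambda)=0$ for every $r\in\mathbb C$ and the multiplier $\Lambda$ of every $n$-cycle of $f_r$, and whose degree in $\lambda$ is the smallest among all nonzero polynomials in $\mathbb C[r][\lambda]$ with this vanishing property. Then for every $n\ge1$: (i) $P_n$ exists and is unique, and $\deg_\lambda P_n(r,\lambda)=L_e(n)$; (ii) for all but finitely many $r\in\mathbb C$, the number of $n$-cycles of $f_r$,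 where a cycle $C$ and its mirror image $-C$ under the symmetry $x\mapsto -x$ of the map are counted as one, is equal to $L_e(n)$; (iii) $N_e(n)=\sum_{d\mid n}L_e(d)$, where $N_e(n)$ is the number of even ternary necklaces of length $n$, that is, of words of length $n$ in the letters $0,1,2$ with even sum of letters, up to rotation. -/

import Mathlib

open Polynomial
open scoped Polynomial.Bivariate

noncomputable section

/-- The cubic map `x ↦ r x - x³`. -/
def cubicMap (r x : ℂ) : ℂ := r * x - x ^ 3

/-- The multiplier `f'(x₁) ⋯ f'(xₙ)` along the first `n` points `x, f x, …, f^{n-1} x` of the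
orbit of `x` under `f = cubicMap r`. -/
def cubicMultiplier (n : ℕ) (r x : ℂ) : ℂ :=
  ∏ k ∈ Finset.range n, deriv (cubicMap r) ((cubicMap r)^[k] x)

/-- `P(r, l) = 0` for every parameter `r` and every multiplier `l` of an `n`-cycle of
`cubicMap r`. Here `P` is a polynomial in an outer variable `Y` (the multiplier `l`) whose
coefficients are polynomials in an inner variable `X` (the parameter `r`). -/
def VanishesOnCubicCycles (n : ℕ) (P : ℂ[X][Y]) : Prop :=
  ∀ r x : ℂ, Function.minimalPeriod (cubicMap r) x = n →
    P.evalEval r (cubicMultiplier n r x) = 0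

/-- `P` is the minimal polynomial of the `n`-cycles: it is monic in the multiplier variable,
it vanishes at the multipliers of all `n`-cycles for all parameters, and no nonzero polynomial
with this property has a smaller degree in the multiplier variable. -/
structure IsCubicCycleMinpoly (n : ℕ) (P : ℂ[X][Y]) : Prop where
  monic : P.Monic
  vanishes : VanishesOnCubicCycles n P
  natDegree_le : ∀ Q : ℂ[X][Y], Q ≠ 0 → VanishesOnCubicCycles n Q → P.natDegree ≤ Q.natDegree

/-- The set of `n`-cycles of `cubicMap r`, each cycle being given as the set of its points. -/
def cubicCycles (n : ℕ) (r : ℂ) : Set (Set ℂ) :=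
  {C | ∃ x : ℂ, Function.minimalPeriod (cubicMap r) x = n ∧
    C = Set.range fun k : ℕ => (cubicMap r)^[k] x}

/-- The `n`-cycles of `cubicMap r` up to the symmetry `x ↦ -x` of the map: the set of all
classes `{C, -C}`, where `C` is an `n`-cycle. -/
def cubicCycleClasses (n : ℕ) (r : ℂ) : Set (Set (Set ℂ)) :=
  {D | ∃ C ∈ cubicCycles n r, D = {C, (fun x : ℂ => -x) '' C}}

/-- Even ternary necklaces of length `n`: words of length `n` in the letters `0, 1, 2`, up to
rotation, whose letters have an even sum. -/
def evenTernaryNecklaces (n : ℕ) : Set (Cycle (Fin 3)) :=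
  {w | w.length = n ∧ Even (w.toMultiset.map fun a : Fin 3 => (a : ℕ)).sum}

/-- `odd(c) = (1 - (-1)^c) / 2`, which is `1` for odd `c` and `0` for even `c`. -/
def oddIndicator (c : ℕ) : ℚ := (1 - (-1) ^ c) / 2

/-- `L_e(n) = (1/n) ∑_{cd = n} μ(c) [1 + odd(c) (3^d - 1)/2]`. -/
def cubicLyndon (n : ℕ) : ℚ :=
  (1 / (n : ℚ)) * ∑ p ∈ n.divisorsAntidiagonal,
    (ArithmeticFunction.moebius p.1 : ℚ) * (1 + oddIndicator p.1 * ((3 ^ p.2 - 1) / 2))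

end

/-! All parameters are treated at once over `ParamRing`, the ring of algebraic functions of `r` that
are integral over `ℂ[r]`. Monic polynomials split there, and each `r` is reached by a specialization
`ParamRing →+* ℂ`. Since all cycles are repelling for large `r`, the equations `fⁿ(x) = ±x` have
`3ⁿ` distinct solutions each in `ParamRing` (`ncard_iterate_eq`), and only finitely many `r` make
periodic points collide.

The core is `cubicDeriv_eq_iff`: over `ParamRing` the multiplier determines the cycle up to sign. It
is not a unit: otherwise the product of all unit multipliers, a Galois invariant, would be a
polynomial in `r` without zeros, hence constant, although it is unbounded as `r → ∞`. So it vanishes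
at some specialization. There, two cycles with the same multiplier both pass through a critical
point; the critical points differ by sign, and a periodic point of multiplier `0` is a simple root
of `fⁿ(x) - x`, so it lifts uniquely. Hence the minimal polynomial is `∏ (λ - t)` over the distinct
multipliers, and its degree is the number of cycles up to sign.

For the count, `2n` times the number of classes is the number of points of period `n` plus the
number of those on cycles with `C = -C`. Summed over the divisors `d` of `n` with `n/d` odd, this
gives `3ⁿ - 1 + 2 odd(n)` for either parity of `n`, and inverting this odd convolution gives `2n
L_e(n)` (`ncard_minimalPeriod_add_ncard_symmetric`). The necklaces are counted by Burnside's lemma;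
the resulting sum is matched with `L_e` by convolution identities. -/

noncomputable section

/-! ### Arithmetic of the numbers `cubicLyndon n` -/

/-- `oddIndicator` as an arithmetic function. -/
def oddArith : ArithmeticFunction ℚ := ⟨oddIndicator, by simp [oddIndicator]⟩

theorem oddArith_apply (n : ℕ) : oddArith n = oddIndicator n := rfl

theorem oddIndicator_of_odd {n : ℕ} (h : Odd n) : oddIndicator n = 1 := by
  simp only [oddIndicator, h.neg_one_pow]; norm_num

theorem oddIndicator_of_even {n : ℕ} (h : Even n) : oddIndicator n = 0 := by
  simp only [oddIndicator, h.neg_one_pow]; norm_num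

theorem oddIndicator_mul (m n : ℕ) :
    oddIndicator (m * n) = oddIndicator m * oddIndicator n := by
  rcases Nat.even_or_odd m with hm | hm
  · rw [oddIndicator_of_even hm, oddIndicator_of_even (hm.mul_right n), zero_mul]
  rcases Nat.even_or_odd n with hn | hn
  · rw [oddIndicator_of_even hn, oddIndicator_of_even (hn.mul_left m), mul_zero]
  · rw [oddIndicator_of_odd hm, oddIndicator_of_odd hn, oddIndicator_of_odd (hm.mul hn), one_mul]

/-- `d ↦ (3 ^ d - 1) / 2` as an arithmetic function. -/
def halfPow : ArithmeticFunction ℚ := ⟨fun d => (3 ^ d - 1) / 2, by simp⟩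

theorem halfPow_apply (n : ℕ) : halfPow n = (3 ^ n - 1) / 2 := rfl

/-- `n ↦ n * cubicLyndon n` as an arithmetic function. -/
def cubicPoints : ArithmeticFunction ℚ := ⟨fun n => n * cubicLyndon n, by simp⟩

theorem cubicPoints_apply (n : ℕ) : cubicPoints n = n * cubicLyndon n := rfl

/-- The Möbius function restricted to odd arguments. -/
def oddMoebius : ArithmeticFunction ℚ :=
  oddArith.pmul (ArithmeticFunction.moebius : ArithmeticFunction ℚ)

theorem coe_moebius_mul_coe_zeta :
    ((ArithmeticFunction.moebius : ArithmeticFunction ℚ) *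
      (ArithmeticFunction.zeta : ArithmeticFunction ℚ)) = 1 :=
  ArithmeticFunction.coe_moebius_mul_coe_zeta

/-- `odd` is completely multiplicative, so twisting by it preserves Dirichlet convolution and
carries `ζ * μ = 1` to this identity. -/
theorem oddArith_mul_oddMoebius : oddArith * oddMoebius = 1 := by
  have key : ∀ n, (oddArith * oddMoebius) n = oddIndicator n *
      ((ArithmeticFunction.zeta : ArithmeticFunction ℚ) *
        (ArithmeticFunction.moebius : ArithmeticFunction ℚ)) n := by
    intro n
    rw [ArithmeticFunction.mul_apply, ArithmeticFunction.mul_apply, Finset.mul_sum]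
    refine Finset.sum_congr rfl fun p hp => ?_
    obtain ⟨hp, hn⟩ := Nat.mem_divisorsAntidiagonal.1 hp
    have h1 : p.1 ≠ 0 := by rintro h; simp [h] at hp; exact hn hp.symm
    rw [← hp, oddIndicator_mul, oddMoebius, ArithmeticFunction.pmul_apply, oddArith_apply,
      oddArith_apply]
    simp [ArithmeticFunction.natCoe_apply, ArithmeticFunction.zeta_apply, h1, mul_assoc]
  ext n
  rw [key, mul_comm (ArithmeticFunction.zeta : ArithmeticFunction ℚ), coe_moebius_mul_coe_zeta]
  by_cases h : n = 1
  · subst h; simp [oddIndicator]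
  · simp [ArithmeticFunction.one_apply_ne h]

theorem cubicPoints_eq : cubicPoints = 1 + oddMoebius * halfPow := by
  ext n
  rcases eq_or_ne n 0 with rfl | hn
  · simp
  rw [ArithmeticFunction.add_apply, ← coe_moebius_mul_coe_zeta, ArithmeticFunction.mul_apply,
    ArithmeticFunction.mul_apply, ← Finset.sum_add_distrib, cubicPoints_apply, cubicLyndon,
    ← mul_assoc, mul_one_div_cancel (by exact_mod_cast hn), one_mul]
  refine Finset.sum_congr rfl fun p hp => ?_
  obtain ⟨hp, hn⟩ := Nat.mem_divisorsAntidiagonal.1 hp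
  have h2 : p.2 ≠ 0 := by rintro h; simp [h] at hp; exact hn hp.symm
  rw [oddMoebius, ArithmeticFunction.pmul_apply, oddArith_apply, halfPow_apply]
  simp only [ArithmeticFunction.natCoe_apply, ArithmeticFunction.zeta_apply, h2, if_false,
    ArithmeticFunction.intCoe_apply]
  push_cast
  ring

/-- The form of the definition of `L_e` that both counts, of cycles and of necklaces, use. -/
theorem oddArith_mul_cubicPoints : oddArith * cubicPoints = oddArith + halfPow := by
  rw [cubicPoints_eq, mul_add, mul_one, ← mul_assoc, oddArith_mul_oddMoebius, one_mul]

/-- Convolution with `oddIndicator` is injective. -/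
theorem eq_of_sum_oddIndicator_eq {u v : ℕ → ℚ} (n : ℕ) (hn : n ≠ 0)
    (h : ∀ m, m ∣ n → ∑ p ∈ m.divisorsAntidiagonal, oddIndicator p.1 * u p.2 =
      ∑ p ∈ m.divisorsAntidiagonal, oddIndicator p.1 * v p.2) : u n = v n := by
  induction n using Nat.strong_induction_on with
  | _ n ih =>
    have h1 : ((1, n) : ℕ × ℕ) ∈ n.divisorsAntidiagonal := by simp [hn]
    have hs := h n dvd_rfl
    rw [← Finset.add_sum_erase _ _ h1, ← Finset.add_sum_erase _ _ h1] at hs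
    have : ∑ p ∈ n.divisorsAntidiagonal.erase (1, n), oddIndicator p.1 * u p.2 =
        ∑ p ∈ n.divisorsAntidiagonal.erase (1, n), oddIndicator p.1 * v p.2 := by
      refine Finset.sum_congr rfl fun p hp => ?_
      obtain ⟨hp1, hp⟩ := Finset.mem_erase.1 hp
      obtain ⟨hp, -⟩ := Nat.mem_divisorsAntidiagonal.1 hp
      have hd : p.2 ∣ n := ⟨p.1, by rw [← hp, mul_comm]⟩
      have hne : p.2 ≠ n := by
        intro h
        refine hp1 (Prod.ext ?_ h)
        rw [h] at hp
        exact Nat.eq_of_mul_eq_mul_right (Nat.pos_of_ne_zero hn) (by simpa using hp)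
      rw [ih p.2 (lt_of_le_of_ne (Nat.le_of_dvd (Nat.pos_of_ne_zero hn) hd) hne)
        (fun h0 => hn (by simpa [h0] using hd)) fun m hm => h m (hm.trans hd)]
    rw [this] at hs
    have := add_right_cancel hs
    simpa [oddIndicator_of_odd odd_one] using this

/-- `c ↦ φ(c) (2 - odd(c))` as an arithmetic function. -/
def twistedTotient : ArithmeticFunction ℚ :=
  ⟨fun c => Nat.totient c * (2 - oddIndicator c), by simp⟩

theorem twistedTotient_apply (c : ℕ) :
    twistedTotient c = Nat.totient c * (2 - oddIndicator c) := rfl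

theorem sum_antidiagonal_totient (n : ℕ) :
    ∑ p ∈ n.divisorsAntidiagonal, (Nat.totient p.1 : ℚ) = n := by
  rw [Nat.sum_divisorsAntidiagonal (f := fun c _ => (Nat.totient c : ℚ))]
  exact_mod_cast Nat.sum_totient n

/-- The full totient sum is `2m`; the factorizations with even second factor correspond to those of
`m` and contribute `m`. -/
theorem sum_totient_mul_oddIndicator_even (m : ℕ) (hm : m ≠ 0) :
    ∑ p ∈ (2 * m).divisorsAntidiagonal, (Nat.totient p.1 : ℚ) * oddIndicator p.2 = m := by
  have h1 : ∑ p ∈ (2 * m).divisorsAntidiagonal, (Nat.totient p.1 : ℚ) = 2 * m := by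
    simpa using sum_antidiagonal_totient (2 * m)
  have h2 : ∑ p ∈ (2 * m).divisorsAntidiagonal, (Nat.totient p.1 : ℚ) * (1 - oddIndicator p.2)
      = m := by
    have h3 : ∑ p ∈ m.divisorsAntidiagonal, (Nat.totient p.1 : ℚ) = m :=
      sum_antidiagonal_totient m
    rw [← h3]
    symm
    refine Finset.sum_of_injOn (fun p => (p.1, 2 * p.2)) ?_ ?_ ?_ ?_
    · rintro ⟨a, b⟩ - ⟨a', b'⟩ - h
      simp only [Prod.mk.injEq] at h ⊢
      omega
    · rintro ⟨a, b⟩ h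
      simp only [Finset.mem_coe, Nat.mem_divisorsAntidiagonal] at h ⊢
      refine ⟨by rw [← h.1]; ring, by omega⟩
    · rintro ⟨a, b⟩ h hne
      simp only [Nat.mem_divisorsAntidiagonal] at h
      rcases Nat.even_or_odd b with hb | hb
      · obtain ⟨c, rfl⟩ := hb
        refine absurd ⟨(a, c), ?_, ?_⟩ hne
        · simp only [Finset.mem_coe, Nat.mem_divisorsAntidiagonal]
          exact ⟨by linarith [h.1, mul_add a c c], hm⟩
        · simp [two_mul]
      · simp [oddIndicator_of_odd hb]
    · rintro ⟨a, b⟩ h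
      simp [oddIndicator_of_even (even_two_mul b)]
  have h5 : ∑ p ∈ (2 * m).divisorsAntidiagonal, (Nat.totient p.1 : ℚ) * (1 - oddIndicator p.2) =
      2 * m - ∑ p ∈ (2 * m).divisorsAntidiagonal, (Nat.totient p.1 : ℚ) * oddIndicator p.2 := by
    rw [← h1, ← Finset.sum_sub_distrib]
    exact Finset.sum_congr rfl fun p _ => by ring
  linarith

/-- For odd `n` the weight `(2 - odd(c)) odd(d)` is `1`; for even `n` it is `2 odd(d)`, because `c`
and `d` are not both odd. -/
theorem twistedTotient_mul_oddArith (n : ℕ) : (twistedTotient * oddArith) n = n := by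
  rcases eq_or_ne n 0 with rfl | hn
  · simp
  rw [ArithmeticFunction.mul_apply]
  rcases Nat.even_or_odd' n with ⟨m, rfl | rfl⟩
  · have : ∀ p ∈ (2 * m).divisorsAntidiagonal, twistedTotient p.1 * oddArith p.2 =
        2 * ((Nat.totient p.1 : ℚ) * oddIndicator p.2) := by
      intro p hp
      obtain ⟨hp, -⟩ := Nat.mem_divisorsAntidiagonal.1 hp
      have hz : oddIndicator p.1 * oddIndicator p.2 = 0 := by
        rw [← oddIndicator_mul, hp, oddIndicator_of_even (even_two_mul m)]
      rw [twistedTotient_apply, oddArith_apply]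
      linear_combination (-(Nat.totient p.1 : ℚ)) * hz
    rw [Finset.sum_congr rfl this, ← Finset.mul_sum,
      sum_totient_mul_oddIndicator_even m (by omega)]
    push_cast; ring
  · have : ∀ p ∈ (2 * m + 1).divisorsAntidiagonal, twistedTotient p.1 * oddArith p.2 =
        (Nat.totient p.1 : ℚ) := by
      intro p hp
      obtain ⟨hp, -⟩ := Nat.mem_divisorsAntidiagonal.1 hp
      have ho : Odd (p.1 * p.2) := by rw [hp]; exact odd_two_mul_add_one m
      rw [Nat.odd_mul] at ho
      rw [twistedTotient_apply, oddArith_apply, oddIndicator_of_odd ho.1,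
        oddIndicator_of_odd ho.2]
      ring
    rw [Finset.sum_congr rfl this, sum_antidiagonal_totient]

/-- The right side is the Burnside sum for even necklaces. Writing `n` as `twistedTotient *
oddArith` lets associativity move `oddArith` onto `cubicPoints`. -/
theorem sum_divisors_cubicLyndon (n : ℕ) :
    (n : ℚ) * ∑ d ∈ n.divisors, cubicLyndon d = ∑ p ∈ n.divisorsAntidiagonal,
      (Nat.totient p.1 : ℚ) * (1 + (2 - oddIndicator p.1) * ((3 ^ p.2 - 1) / 2)) := by
  have h1 : (n : ℚ) * ∑ d ∈ n.divisors, cubicLyndon d =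
      ((twistedTotient * oddArith) * cubicPoints) n := by
    rw [ArithmeticFunction.mul_apply, Finset.mul_sum,
      ← Nat.sum_divisorsAntidiagonal' (f := fun _ d => (n : ℚ) * cubicLyndon d)]
    refine Finset.sum_congr rfl fun p hp => ?_
    rw [twistedTotient_mul_oddArith, cubicPoints_apply,
      ← (Nat.mem_divisorsAntidiagonal.1 hp).1]
    push_cast; ring
  have h2 : ∑ p ∈ n.divisorsAntidiagonal, (Nat.totient p.1 : ℚ) = n :=
    sum_antidiagonal_totient n
  rw [h1, mul_assoc, oddArith_mul_cubicPoints, mul_add, ArithmeticFunction.add_apply,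
    twistedTotient_mul_oddArith, ArithmeticFunction.mul_apply, ← h2, ← Finset.sum_add_distrib]
  refine Finset.sum_congr rfl fun p _ => ?_
  rw [twistedTotient_apply, halfPow_apply]
  ring

/-! ### Counting the cycles of an odd map up to sign -/

open Function in
theorem sum_oddIndicator_ncard_minimalPeriod {A : Type*} (f : A → A) (q : A → Prop) {n : ℕ}
    (hn : n ≠ 0) (hfin : {x | f^[n] x = x}.Finite) :
    ∑ p ∈ n.divisorsAntidiagonal,
      oddIndicator p.1 * ({x | q x ∧ minimalPeriod f x = p.2}.ncard : ℚ) =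
    ({x | q x ∧ ∃ c, Odd c ∧ c * minimalPeriod f x = n}.ncard : ℚ) := by
  classical
  have hsub : {x | q x ∧ ∃ c, Odd c ∧ c * minimalPeriod f x = n}.Finite := by
    refine hfin.subset ?_
    rintro x ⟨-, c, -, hc⟩
    exact (isPeriodicPt_iff_minimalPeriod_dvd.2 ⟨c, by rw [← hc, mul_comm]⟩ :
      IsPeriodicPt f n x)
  set F := hsub.toFinset with hF
  have hmaps : ∀ x ∈ F, ((n / minimalPeriod f x, minimalPeriod f x) : ℕ × ℕ) ∈
      n.divisorsAntidiagonal := by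
    intro x hx
    obtain ⟨-, c, -, hc⟩ := hsub.mem_toFinset.1 hx
    rw [Nat.mem_divisorsAntidiagonal]
    exact ⟨Nat.div_mul_cancel ⟨c, by rw [← hc, mul_comm]⟩, hn⟩
  rw [Set.ncard_eq_toFinset_card _ hsub, Finset.card_eq_sum_card_fiberwise hmaps]
  push_cast
  refine Finset.sum_congr rfl fun p hp => ?_
  obtain ⟨hp, -⟩ := Nat.mem_divisorsAntidiagonal.1 hp
  have hp2 : 0 < p.2 := Nat.pos_of_ne_zero fun h => hn (by rw [← hp, h, mul_zero])
  rcases Nat.even_or_odd p.1 with he | ho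
  · rw [oddIndicator_of_even he, zero_mul, eq_comm, Nat.cast_eq_zero, Finset.card_eq_zero,
      Finset.filter_eq_empty_iff]
    rintro x hx rfl
    obtain ⟨-, c, hc, hcn⟩ := hsub.mem_toFinset.1 hx
    have h1 : n / minimalPeriod f x = c := by
      rw [← hcn]; exact Nat.mul_div_cancel _ hp2
    simp only [h1] at he
    exact (Nat.not_even_iff_odd.2 hc) he
  · rw [oddIndicator_of_odd ho, one_mul, ← Set.ncard_coe_finset]
    congr 2
    ext x
    simp only [Finset.coe_filter, Set.mem_ofPred_eq, hF, Set.Finite.mem_toFinset]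
    constructor
    · rintro ⟨hq, hx⟩
      refine ⟨⟨hq, p.1, ho, by rw [hx, hp]⟩, Prod.ext ?_ hx⟩
      simp only [hx]
      rw [← hp]; exact Nat.mul_div_cancel _ hp2
    · rintro ⟨⟨hq, -⟩, hx⟩
      exact ⟨hq, congrArg Prod.snd hx⟩

open Function in
theorem odd_cofactor_of_odd {A : Type*} (f : A → A) {n : ℕ} (ho : Odd n) :
    {x | True ∧ ∃ c, Odd c ∧ c * minimalPeriod f x = n} = {x | f^[n] x = x} := by
  ext x
  simp only [true_and, Set.mem_ofPred_eq]
  constructor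
  · rintro ⟨c, -, hc⟩
    exact (isPeriodicPt_iff_minimalPeriod_dvd.2 ⟨c, by rw [← hc, mul_comm]⟩ : IsPeriodicPt f n x)
  · intro h
    obtain ⟨c, hc⟩ := isPeriodicPt_iff_minimalPeriod_dvd.1 (h : IsPeriodicPt f n x)
    exact ⟨c, (Nat.odd_mul.1 (hc ▸ ho)).2, by rw [hc, mul_comm]⟩

-- A period dividing `2m` has odd cofactor exactly when it does not divide `m`.
open Function in
theorem odd_cofactor_two_mul {A : Type*} (f : A → A) {m : ℕ} (hm : m ≠ 0) :
    {x | True ∧ ∃ c, Odd c ∧ c * minimalPeriod f x = 2 * m} =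
      {x | f^[2 * m] x = x} \ {x | f^[m] x = x} := by
  ext x
  simp only [true_and, Set.mem_ofPred_eq, Set.mem_sdiff]
  constructor
  · rintro ⟨c, hc, hcm⟩
    refine ⟨(isPeriodicPt_iff_minimalPeriod_dvd.2 ⟨c, by rw [← hcm, mul_comm]⟩ :
      IsPeriodicPt f (2 * m) x), fun h => ?_⟩
    obtain ⟨k, hk⟩ := isPeriodicPt_iff_minimalPeriod_dvd.1 (h : IsPeriodicPt f m x)
    have h0 : 0 < minimalPeriod f x :=
      Nat.pos_of_ne_zero fun h0 => hm (by rw [hk, h0, zero_mul])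
    have : c = 2 * k := by
      refine Nat.eq_of_mul_eq_mul_right h0 ?_
      rw [hcm]; nlinarith
    rw [this] at hc
    exact (Nat.not_odd_iff_even.2 (even_two_mul k)) hc
  · rintro ⟨h, h'⟩
    obtain ⟨c, hc⟩ := isPeriodicPt_iff_minimalPeriod_dvd.1 (h : IsPeriodicPt f (2 * m) x)
    refine ⟨c, ?_, by rw [hc, mul_comm]⟩
    by_contra hco
    obtain ⟨k, hk⟩ := even_iff_two_dvd.1 (Nat.not_odd_iff_even.1 hco)
    refine h' (isPeriodicPt_iff_minimalPeriod_dvd.2 ⟨k, ?_⟩ : IsPeriodicPt f m x)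
    rw [hk] at hc
    linarith

section OddMap

open Function

variable {A : Type*} [AddCommGroup A] {f : A → A}

theorem iterate_neg_of_odd (hodd : ∀ x, f (-x) = -f x) (n : ℕ) (x : A) :
    f^[n] (-x) = -f^[n] x := by
  have h : Function.Commute f (fun x : A => -x) := fun x => hodd x
  exact (h.iterate_left n) x

theorem minimalPeriod_neg_of_odd (hodd : ∀ x, f (-x) = -f x) (x : A) :
    minimalPeriod f (-x) = minimalPeriod f x := by
  refine minimalPeriod_eq_minimalPeriod_iff.2 fun n => ?_
  simp only [IsPeriodicPt, IsFixedPt, iterate_neg_of_odd hodd, neg_inj]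

theorem map_zero_of_odd (hodd : ∀ x, f (-x) = -f x) (hneg : ∀ x : A, -x = x → x = 0) :
    f 0 = 0 := by
  have := hodd 0
  rw [neg_zero] at this
  exact hneg _ this.symm

theorem minimalPeriod_zero_of_odd (hodd : ∀ x, f (-x) = -f x) (hneg : ∀ x : A, -x = x → x = 0) :
    minimalPeriod f 0 = 1 :=
  minimalPeriod_eq_one_iff_isFixedPt.2 (map_zero_of_odd hodd hneg)

/-- A symmetric cycle through a point other than `0` has even length. -/
theorem symmetric_odd_cofactor_of_odd (hodd : ∀ x, f (-x) = -f x)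
    (hneg : ∀ x : A, -x = x → x = 0) {n : ℕ} (ho : Odd n) :
    {x | (∃ j, f^[j] x = -x) ∧ ∃ c, Odd c ∧ c * minimalPeriod f x = n} = {0} := by
  ext x
  simp only [Set.mem_ofPred_eq, Set.mem_singleton_iff]
  constructor
  · rintro ⟨⟨j, hj⟩, c, -, hc⟩
    have h2 : IsPeriodicPt f (2 * j) x := by
      rw [IsPeriodicPt, IsFixedPt, two_mul, iterate_add_apply, hj, iterate_neg_of_odd hodd, hj,
        neg_neg]
    have hd : minimalPeriod f x ∣ j := by
      have ho' : Odd (minimalPeriod f x) := (Nat.odd_mul.1 (hc ▸ ho)).2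
      exact (Nat.Coprime.dvd_mul_left (ho'.coprime_two_right)).1
        (isPeriodicPt_iff_minimalPeriod_dvd.1 h2)
    have h1 : f^[j] x = x := (isPeriodicPt_iff_minimalPeriod_dvd.2 hd : IsPeriodicPt f j x)
    exact hneg x (hj.symm.trans h1)
  · rintro rfl
    exact ⟨⟨0, by simp⟩, n, ho, by rw [minimalPeriod_zero_of_odd hodd hneg, mul_one]⟩

/-- On a symmetric cycle of length `2q` other than `{0}` the half turn `f^q` is `x ↦ -x`, and so is
`f^m` for every odd multiple `m` of `q`. -/
theorem symmetric_odd_cofactor_two_mul (hodd : ∀ x, f (-x) = -f x)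
    (hneg : ∀ x : A, -x = x → x = 0) {m : ℕ} (hm : m ≠ 0) :
    {x | (∃ j, f^[j] x = -x) ∧ ∃ c, Odd c ∧ c * minimalPeriod f x = 2 * m} =
      {x | f^[m] x = -x} \ {0} := by
  ext x
  simp only [Set.mem_ofPred_eq, Set.mem_singleton_iff, Set.mem_sdiff]
  constructor
  · rintro ⟨⟨j, hj⟩, c, hco, hc⟩
    have hx0 : x ≠ 0 := by
      rintro rfl
      rw [minimalPeriod_zero_of_odd hodd hneg, mul_one] at hc
      rw [hc] at hco
      exact (Nat.not_odd_iff_even.2 (even_two_mul m)) hco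
    have h2 : IsPeriodicPt f (2 * j) x := by
      rw [IsPeriodicPt, IsFixedPt, two_mul, iterate_add_apply, hj, iterate_neg_of_odd hodd, hj,
        neg_neg]
    have hpe : 2 ∣ minimalPeriod f x :=
      (Nat.Coprime.dvd_mul_left (hco.coprime_two_left)).1 ⟨m, hc⟩
    obtain ⟨q, hq⟩ := hpe
    have hmq : m = c * q := by
      rw [hq] at hc; linarith
    obtain ⟨k, hk⟩ := isPeriodicPt_iff_minimalPeriod_dvd.1 h2
    have hjq : j = k * q := by
      rw [hq] at hk; linarith
    -- For even `k` the exponent `j` would be a period, giving `x = -x`.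
    have hko : Odd k := by
      by_contra hke
      obtain ⟨l, rfl⟩ := even_iff_two_dvd.1 (Nat.not_odd_iff_even.1 hke)
      have : IsPeriodicPt f j x :=
        isPeriodicPt_iff_minimalPeriod_dvd.2 ⟨l, by rw [hjq, hq]; ring⟩
      exact hx0 (hneg x (hj.symm.trans this))
    have hred : ∀ i, Odd i → f^[i * q] x = f^[q] x := by
      rintro i ⟨l, rfl⟩
      have h3 : (2 * l + 1) * q = q + minimalPeriod f x * l := by rw [hq]; ring
      rw [h3, iterate_add_apply,
        ((isPeriodicPt_minimalPeriod f x).const_mul l |> fun h => by rwa [mul_comm] at h :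
          IsPeriodicPt f (minimalPeriod f x * l) x)]
    refine ⟨?_, hx0⟩
    rw [hmq, hred c hco, ← hred k hko, ← hjq, hj]
  · rintro ⟨h, hx0⟩
    refine ⟨⟨m, h⟩, ?_⟩
    have h2 : IsPeriodicPt f (2 * m) x := by
      rw [IsPeriodicPt, IsFixedPt, two_mul, iterate_add_apply, h, iterate_neg_of_odd hodd, h,
        neg_neg]
    have hmem : x ∈ {x | f^[2 * m] x = x} \ {x | f^[m] x = x} :=
      ⟨h2, fun h1 => hx0 (hneg x (h.symm.trans h1))⟩
    rw [← odd_cofactor_two_mul f hm] at hmem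
    exact hmem.2

/-- Under the odd convolution the left side becomes `3^k + 1` for odd `k` and `(3^(2m) - 3^m) + (3^m
- 1)` for `k = 2m`; in both cases this is `3^k - 1 + 2 odd(k)`. -/
theorem ncard_minimalPeriod_add_ncard_symmetric (hodd : ∀ x, f (-x) = -f x)
    (hneg : ∀ x : A, -x = x → x = 0) {n : ℕ} (hn : n ≠ 0)
    (hX : ∀ d, d ∣ n → {x | f^[d] x = x}.ncard = 3 ^ d)
    (hT : ∀ d, 2 * d ∣ n → {x | f^[d] x = -x}.ncard = 3 ^ d) :
    (({x | minimalPeriod f x = n}.ncard : ℚ) +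
      {x | (∃ j, f^[j] x = -x) ∧ minimalPeriod f x = n}.ncard) = 2 * (n * cubicLyndon n) := by
  refine eq_of_sum_oddIndicator_eq
    (u := fun n => (({x | minimalPeriod f x = n}.ncard : ℚ) +
      {x | (∃ j, f^[j] x = -x) ∧ minimalPeriod f x = n}.ncard))
    (v := fun n => 2 * (n * cubicLyndon n)) n hn fun k hk => ?_
  have hk0 : k ≠ 0 := fun h => hn (by simpa [h] using hk)
  have hfin : ∀ d, d ∣ n → {x | f^[d] x = x}.Finite := fun d hd =>
    Set.finite_of_ncard_pos (by rw [hX d hd]; positivity)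
  have h1 := sum_oddIndicator_ncard_minimalPeriod f (fun _ => True) hk0 (hfin k hk)
  have h2 := sum_oddIndicator_ncard_minimalPeriod f (fun x => ∃ j, f^[j] x = -x) hk0 (hfin k hk)
  have h3 : ∑ p ∈ k.divisorsAntidiagonal, oddIndicator p.1 * (2 * (p.2 * cubicLyndon p.2)) =
      2 * (oddIndicator k + (3 ^ k - 1) / 2) := by
    have := congrArg (fun g : ArithmeticFunction ℚ => g k) oddArith_mul_cubicPoints
    simp only [ArithmeticFunction.mul_apply, ArithmeticFunction.add_apply, oddArith_apply,
      halfPow_apply, cubicPoints_apply] at this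
    rw [← this, Finset.mul_sum]
    exact Finset.sum_congr rfl fun p _ => by ring
  rw [h3]
  simp only [mul_add, Finset.sum_add_distrib]
  rw [h2]
  simp only [true_and] at h1
  rw [h1]
  have hE : ∀ k, {x | ∃ c, Odd c ∧ c * minimalPeriod f x = k} =
      {x | True ∧ ∃ c, Odd c ∧ c * minimalPeriod f x = k} := by simp
  rw [hE]
  rcases Nat.even_or_odd' k with ⟨m, rfl | rfl⟩
  · have hm : m ≠ 0 := by omega
    have hmk : m ∣ n := (Dvd.intro_left 2 rfl).trans hk
    rw [odd_cofactor_two_mul f hm, symmetric_odd_cofactor_two_mul hodd hneg hm]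
    have hsub : {x | f^[m] x = x} ⊆ {x | f^[2 * m] x = x} := fun x hx =>
      (IsPeriodicPt.const_mul (hx : IsPeriodicPt f m x) 2 : IsPeriodicPt f (2 * m) x)
    have e1 := Set.ncard_sdiff_add_ncard_of_subset hsub (hfin _ hk)
    have h0 : (0 : A) ∈ {x | f^[m] x = -x} := by
      have : f^[m] 0 = 0 := (IsFixedPt.iterate (map_zero_of_odd hodd hneg) m)
      simp [this]
    have e2 := Set.ncard_sdiff_singleton_add_one h0
      (Set.finite_of_ncard_pos (by rw [hT m hk]; positivity))
    rw [hX _ hk, hX _ hmk] at e1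
    rw [hT _ hk] at e2
    have e1' := congrArg (Nat.cast : ℕ → ℚ) e1
    have e2' := congrArg (Nat.cast : ℕ → ℚ) e2
    push_cast at e1' e2'
    rw [oddIndicator_of_even (even_two_mul m)]
    linarith
  · have ho : Odd (2 * m + 1) := odd_two_mul_add_one m
    rw [odd_cofactor_of_odd f ho, symmetric_odd_cofactor_of_odd hodd hneg ho, hX _ hk,
      oddIndicator_of_odd ho, Set.ncard_singleton]
    push_cast
    ring

/-- Counting the points of minimal period `n` along the fibres of a complete invariant of the
cycles up to sign. -/
theorem two_mul_ncard_image (hodd : ∀ x, f (-x) = -f x) {n : ℕ} (hn : n ≠ 0)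
    (hfin : {x | minimalPeriod f x = n}.Finite) {B : Type*} (g : A → B)
    (hg : ∀ x y, minimalPeriod f x = n → minimalPeriod f y = n →
      (g x = g y ↔ ∃ j, y = f^[j] x ∨ y = -f^[j] x)) :
    2 * n * (g '' {x | minimalPeriod f x = n}).ncard = {x | minimalPeriod f x = n}.ncard +
      {x | (∃ j, f^[j] x = -x) ∧ minimalPeriod f x = n}.ncard := by
  classical
  set Z := hfin.toFinset with hZ
  have hZm : ∀ x, x ∈ Z ↔ minimalPeriod f x = n := fun x => by simp [hZ]
  have hZs : {x | minimalPeriod f x = n} = (Z : Set A) := by ext x; simp [hZm]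
  have hS : {x | (∃ j, f^[j] x = -x) ∧ minimalPeriod f x = n} =
      ((Z.filter fun x => ∃ j, f^[j] x = -x : Finset A) : Set A) := by
    ext x; simp [hZm, and_comm]
  rw [hS, hZs, ← Finset.coe_image, Set.ncard_coe_finset, Set.ncard_coe_finset,
    Set.ncard_coe_finset]
  have hmaps : ∀ x ∈ Z, g x ∈ Z.image g := fun x hx => Finset.mem_image_of_mem g hx
  rw [Finset.card_eq_sum_card_fiberwise hmaps,
    Finset.card_eq_sum_card_fiberwise (s := Z.filter fun x => ∃ j, f^[j] x = -x)
      (fun x hx => hmaps x (Finset.mem_filter.1 hx).1), ← Finset.sum_add_distrib,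
    mul_comm, ← smul_eq_mul, eq_comm]
  refine Finset.sum_eq_card_nsmul ?_
  intro b hb
  obtain ⟨x, hx, rfl⟩ := Finset.mem_image.1 hb
  rw [hZm] at hx
  have hper : x ∈ periodicPts f :=
    minimalPeriod_pos_iff_mem_periodicPts.1 (by rw [hx]; exact Nat.pos_of_ne_zero hn)
  have hmp : ∀ j, minimalPeriod f (f^[j] x) = n := fun j => by
    rw [minimalPeriod_apply_iterate hper, hx]
  have hmp' : ∀ j, minimalPeriod f (-f^[j] x) = n := fun j => by
    rw [minimalPeriod_neg_of_odd hodd, hmp]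
  have hlt : ∀ j, ∃ i < n, f^[j] x = f^[i] x := fun j =>
    ⟨j % n, Nat.mod_lt _ (Nat.pos_of_ne_zero hn), by
      rw [← hx, iterate_mod_minimalPeriod_eq]⟩
  set O₁ := (Finset.range n).image fun j => f^[j] x with hO₁
  have hO₁m : ∀ y, y ∈ O₁ ↔ ∃ j, y = f^[j] x := by
    intro y
    simp only [hO₁, Finset.mem_image, Finset.mem_range]
    constructor
    · rintro ⟨j, -, rfl⟩; exact ⟨j, rfl⟩
    · rintro ⟨j, rfl⟩
      obtain ⟨i, hi, h⟩ := hlt j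
      exact ⟨i, hi, h.symm⟩
  have hcard : O₁.card = n := by
    rw [hO₁, Finset.card_image_of_injOn, Finset.card_range]
    intro i hi j hj h
    simp only [Finset.coe_range, Set.mem_Iio] at hi hj
    exact iterate_injOn_Iio_minimalPeriod (f := f) (x := x) (by simpa [hx] using hi)
      (by simpa [hx] using hj) h
  -- The fibre of a symmetric cycle has `n` points, counted in both summands; any other fibre has
  -- `2n` points, counted in the first summand only.
  by_cases hs : ∃ j, f^[j] x = -x
  · obtain ⟨i, hi⟩ := hs
    have hneg : ∀ j, -f^[j] x = f^[j + i] x := fun j => by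
      rw [iterate_add_apply, hi, iterate_neg_of_odd hodd]
    have e1 : Z.filter (fun y => g y = g x) = O₁ := by
      ext y
      rw [Finset.mem_filter, hZm, hO₁m]
      constructor
      · rintro ⟨hy, h⟩
        obtain ⟨j, rfl | rfl⟩ := (hg x y hx hy).1 h.symm
        · exact ⟨j, rfl⟩
        · exact ⟨j + i, hneg j⟩
      · rintro ⟨j, rfl⟩
        exact ⟨hmp j, ((hg x _ hx (hmp j)).2 ⟨j, Or.inl rfl⟩).symm⟩
    have e2 : (Z.filter fun x => ∃ j, f^[j] x = -x).filter (fun y => g y = g x) = O₁ := by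
      rw [Finset.filter_comm, e1, Finset.filter_true_of_mem]
      intro y hy
      obtain ⟨j, rfl⟩ := (hO₁m y).1 hy
      exact ⟨i, by rw [hneg, add_comm, iterate_add_apply]⟩
    rw [e1, e2, hcard, two_mul]
  · have e1 : Z.filter (fun y => g y = g x) = O₁ ∪ O₁.image fun y => -y := by
      ext y
      rw [Finset.mem_filter, hZm, Finset.mem_union, hO₁m, Finset.mem_image]
      constructor
      · rintro ⟨hy, h⟩
        obtain ⟨j, h | h⟩ := (hg x y hx hy).1 h.symm
        · exact Or.inl ⟨j, h⟩
        · exact Or.inr ⟨f^[j] x, (hO₁m _).2 ⟨j, rfl⟩, h.symm⟩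
      · rintro (⟨j, rfl⟩ | ⟨z, hz, rfl⟩)
        · exact ⟨hmp j, ((hg x _ hx (hmp j)).2 ⟨j, Or.inl rfl⟩).symm⟩
        · obtain ⟨j, rfl⟩ := (hO₁m z).1 hz
          exact ⟨hmp' j, ((hg x _ hx (hmp' j)).2 ⟨j, Or.inr rfl⟩).symm⟩
    have hdisj : Disjoint O₁ (O₁.image fun y => -y) := by
      rw [Finset.disjoint_left]
      intro y hy hy'
      obtain ⟨z, hz, hzy⟩ := Finset.mem_image.1 hy'
      obtain ⟨j, rfl⟩ := (hO₁m y).1 hy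
      obtain ⟨i, rfl⟩ := (hO₁m z).1 hz
      -- On the cycle `f^(nj - j)` inverts `f^j`.
      refine hs ⟨n * j - j + i, ?_⟩
      have hj : j ≤ n * j := Nat.le_mul_of_pos_left j (Nat.pos_of_ne_zero hn)
      have h3 : f^[n * j] x = x := by
        have := (isPeriodicPt_minimalPeriod f x).mul_const j
        rw [hx] at this
        exact this
      have h4 : f^[i] x = -f^[j] x := by rw [← hzy, neg_neg]
      rw [iterate_add_apply, h4, iterate_neg_of_odd hodd, ← iterate_add_apply,
        Nat.sub_add_cancel hj, h3]
    have e2 : (Z.filter fun x => ∃ j, f^[j] x = -x).filter (fun y => g y = g x) = ∅ := by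
      rw [Finset.filter_filter, Finset.filter_eq_empty_iff]
      rintro y hy ⟨⟨i, hi⟩, h⟩
      obtain ⟨j, h' | h'⟩ := (hg y x ((hZm y).1 hy) hx).1 h
      · exact hs ⟨i, by rw [h', ← iterate_add_apply, add_comm, iterate_add_apply, hi,
          iterate_neg_of_odd hodd]⟩
      · exact hs ⟨i, by rw [h', iterate_neg_of_odd hodd, ← iterate_add_apply, add_comm,
          iterate_add_apply, hi, iterate_neg_of_odd hodd]⟩
    rw [e1, e2, Finset.card_union_of_disjoint hdisj,
      Finset.card_image_of_injective _ neg_injective, hcard, Finset.card_empty, two_mul, add_zero]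

/-- Stated for an arbitrary invariant `g` because it serves twice: over `ParamRing` with the
multiplier, over `ℂ` with the class `{C, -C}`. -/
theorem ncard_image_eq_cubicLyndon (hodd : ∀ x, f (-x) = -f x)
    (hneg : ∀ x : A, -x = x → x = 0) {n : ℕ} (hn : n ≠ 0)
    (hX : ∀ d, d ∣ n → {x | f^[d] x = x}.ncard = 3 ^ d)
    (hT : ∀ d, 2 * d ∣ n → {x | f^[d] x = -x}.ncard = 3 ^ d) {B : Type*} (g : A → B)
    (hg : ∀ x y, minimalPeriod f x = n → minimalPeriod f y = n →
      (g x = g y ↔ ∃ j, y = f^[j] x ∨ y = -f^[j] x)) :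
    ((g '' {x | minimalPeriod f x = n}).ncard : ℚ) = cubicLyndon n := by
  have hfin : {x | minimalPeriod f x = n}.Finite := by
    refine (Set.finite_of_ncard_pos (by rw [hX n dvd_rfl]; positivity) :
      {x | f^[n] x = x}.Finite).subset ?_
    rintro x rfl
    exact iterate_minimalPeriod
  have h1 := congrArg (Nat.cast : ℕ → ℚ) (two_mul_ncard_image hodd hn hfin g hg)
  push_cast at h1
  rw [ncard_minimalPeriod_add_ncard_symmetric hodd hneg hn hX hT] at h1
  have h2 : (2 * n : ℚ) ≠ 0 := by positivity
  refine mul_left_cancel₀ h2 ?_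
  rw [h1]; ring

end OddMap

/-! ### Even ternary necklaces -/

/-- The sum of the letters of a ternary word. -/
def letterSum (l : List (Fin 3)) : ℕ := (l.map fun a : Fin 3 => (a : ℕ)).sum

theorem letterSum_append (l l' : List (Fin 3)) :
    letterSum (l ++ l') = letterSum l + letterSum l' := by
  simp [letterSum]

theorem letterSum_rotate (l : List (Fin 3)) (k : ℕ) : letterSum (l.rotate k) = letterSum l := by
  unfold letterSum
  exact ((List.rotate_perm l k).map _).sum_eq

theorem letterSum_flatten_replicate (c : ℕ) (u : List (Fin 3)) :
    letterSum (List.replicate c u).flatten = c * letterSum u := by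
  induction c with
  | zero => simp [letterSum]
  | succ c ih => rw [List.replicate_succ, List.flatten_cons, letterSum_append, ih]; ring

theorem ncard_words (d : ℕ) : {u : List (Fin 3) | u.length = d}.ncard = 3 ^ d := by
  rw [← Nat.card_coe_set_eq]
  exact (Nat.card_eq_fintype_card (α := List.Vector (Fin 3) d)).trans (by simp)

theorem finite_words (d : ℕ) : {u : List (Fin 3) | u.length = d}.Finite :=
  Set.finite_of_ncard_pos (by rw [ncard_words]; positivity)

theorem ncard_even_words (d : ℕ) :
    ({u : List (Fin 3) | u.length = d ∧ Even (letterSum u)}.ncard : ℚ) = (3 ^ d + 1) / 2 := by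
  induction d with
  | zero =>
    have : {u : List (Fin 3) | u.length = 0 ∧ Even (letterSum u)} = {[]} := by
      ext u
      simp only [List.length_eq_zero_iff, Set.mem_ofPred_eq, Set.mem_singleton_iff]
      exact ⟨fun h => h.1, by rintro rfl; simp [letterSum]⟩
    rw [this, Set.ncard_singleton]; norm_num
  | succ d ih =>
    set E := {u : List (Fin 3) | u.length = d ∧ Even (letterSum u)} with hE
    set T := {u : List (Fin 3) | u.length = d} with hT
    have hET : E ⊆ T := fun u hu => hu.1
    have hTf : T.Finite := finite_words d
    have hEf := hTf.subset hET
    have hDf : (T \ E).Finite := hTf.subset Set.sdiff_subset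
    -- A first letter `0` or `2` keeps the parity and `1` flips it, so `e(d+1) = 2 e(d) + (3^d -
    -- e(d))`.
    have hdec : {u : List (Fin 3) | u.length = d + 1 ∧ Even (letterSum u)} =
        (List.cons 0 '' E) ∪ ((List.cons 2 '' E) ∪ (List.cons 1 '' (T \ E))) := by
      ext u
      rcases u with _ | ⟨a, u⟩
      · simp
      · have h2 : Even (2 + letterSum u) ↔ Even (letterSum u) := by
          simp [Nat.even_add]
        have h1 : Even (1 + letterSum u) ↔ ¬ Even (letterSum u) := by
          simp [Nat.even_add]
        fin_cases a <;> simp [hE, hT, letterSum] at * <;> grind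
    have hinj : ∀ a : Fin 3, Function.Injective (List.cons a) := fun a => List.cons_injective
    have hd1 : Disjoint (List.cons (2 : Fin 3) '' E) (List.cons 1 '' (T \ E)) := by
      rw [Set.disjoint_left]
      rintro _ ⟨u, -, rfl⟩ ⟨v, -, h⟩
      simp at h
    have hd2 : Disjoint (List.cons (0 : Fin 3) '' E)
        ((List.cons 2 '' E) ∪ (List.cons 1 '' (T \ E))) := by
      rw [Set.disjoint_left]
      rintro _ ⟨u, -, rfl⟩ (⟨v, -, h⟩ | ⟨v, -, h⟩) <;> simp at h
    rw [hdec, Set.ncard_union_eq hd2 (hEf.image _) ((hEf.image _).union (hDf.image _)),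
      Set.ncard_union_eq hd1 (hEf.image _) (hDf.image _), Set.ncard_image_of_injective _ (hinj _),
      Set.ncard_image_of_injective _ (hinj _), Set.ncard_image_of_injective _ (hinj _)]
    have h3 := Set.ncard_sdiff_add_ncard_of_subset hET hTf
    rw [ncard_words d] at h3
    have h3' := congrArg (Nat.cast : ℕ → ℚ) h3
    push_cast at h3' ⊢
    rw [ih] at h3' ⊢
    rw [pow_succ]
    linarith

theorem eq_flatten_replicate_of_append_comm {α : Type*} (t : List α) :
    ∀ (c : ℕ) (r : List α), r.length = c * t.length → r ++ t = t ++ r →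
      r = (List.replicate c t).flatten := by
  intro c
  induction c with
  | zero =>
    intro r hr _
    simpa using hr
  | succ c ih =>
    intro r hr h
    have hle : t.length ≤ r.length := by rw [hr]; nlinarith
    have hpre : t <+: r :=
      List.prefix_of_prefix_length_le ⟨r, h.symm⟩ (List.prefix_append r t) hle
    obtain ⟨r', rfl⟩ := hpre
    rw [List.append_assoc, List.append_cancel_left_eq] at h
    rw [List.replicate_succ, List.flatten_cons, ← ih r' ?_ h]
    rw [List.length_append] at hr
    linarith [add_mul c 1 t.length]

/-- The words of length `c * d` that are invariant under rotation by `d` are the `c`-th powers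
of the words of length `d`. -/
theorem rotate_eq_self_iff_exists_flatten_replicate {α : Type*} {c d : ℕ} (hc : c ≠ 0)
    (l : List α) : (l.length = c * d ∧ l.rotate d = l) ↔
      ∃ u : List α, u.length = d ∧ (List.replicate c u).flatten = l := by
  obtain ⟨c, rfl⟩ := Nat.exists_eq_succ_of_ne_zero hc
  constructor
  · rintro ⟨hl, h⟩
    have hd : d ≤ l.length := by rw [hl]; nlinarith
    refine ⟨l.take d, by simp [hd], ?_⟩
    have ht : (l.take d).length = d := by simp [hd]
    rw [List.rotate_eq_drop_append_take hd] at h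
    have h2 : l.drop d ++ l.take d = l.take d ++ l.drop d := by
      rw [h, List.take_append_drop]
    have h3 := eq_flatten_replicate_of_append_comm (l.take d) c (l.drop d)
      (by rw [ht, List.length_drop, hl, Nat.succ_mul, Nat.add_sub_cancel]) h2
    rw [Nat.succ_eq_add_one, List.replicate_succ, List.flatten_cons, ← h3,
      List.take_append_drop]
  · rintro ⟨u, rfl, rfl⟩
    refine ⟨by simp, ?_⟩
    rw [Nat.succ_eq_add_one, List.replicate_succ, List.flatten_cons,
      List.rotate_append_length_eq]
    have : ∀ k, (List.replicate k u).flatten ++ u = u ++ (List.replicate k u).flatten := by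
      intro k
      induction k with
      | zero => simp
      | succ k ih => rw [List.replicate_succ, List.flatten_cons, List.append_assoc, ih]
    exact this c

theorem flatten_replicate_injOn {α : Type*} {c : ℕ} (hc : c ≠ 0) (d : ℕ) :
    Set.InjOn (fun u : List α => (List.replicate c u).flatten) {u | u.length = d} := by
  obtain ⟨c, rfl⟩ := Nat.exists_eq_succ_of_ne_zero hc
  intro u hu v hv h
  simp only [Nat.succ_eq_add_one, List.replicate_succ, List.flatten_cons] at h
  exact (List.append_inj h (hu.trans hv.symm)).1

/-- The fixed words are powers `u^c`, with letter sum `c` times that of `u`: for even `c` all `3^d`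
words `u` qualify, for odd `c` only the `(3^d + 1)/2` even ones. -/
theorem ncard_even_rotate_eq_self {c d : ℕ} (hc : c ≠ 0) :
    ({l : List (Fin 3) | (l.length = c * d ∧ Even (letterSum l)) ∧ l.rotate d = l}.ncard : ℚ) =
      1 + (2 - oddIndicator c) * ((3 ^ d - 1) / 2) := by
  have himg : {l : List (Fin 3) | (l.length = c * d ∧ Even (letterSum l)) ∧ l.rotate d = l} =
      (fun u => (List.replicate c u).flatten) ''
        {u : List (Fin 3) | u.length = d ∧ Even (c * letterSum u)} := by
    ext l
    simp only [Set.mem_image, Set.mem_ofPred_eq]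
    constructor
    · rintro ⟨⟨hl, he⟩, hr⟩
      obtain ⟨u, hu, rfl⟩ := (rotate_eq_self_iff_exists_flatten_replicate hc l).1 ⟨hl, hr⟩
      exact ⟨u, ⟨hu, by rwa [letterSum_flatten_replicate] at he⟩, rfl⟩
    · rintro ⟨u, ⟨hu, he⟩, rfl⟩
      obtain ⟨h1, h2⟩ := (rotate_eq_self_iff_exists_flatten_replicate hc _).2 ⟨u, hu, rfl⟩
      exact ⟨⟨h1, by rwa [letterSum_flatten_replicate]⟩, h2⟩
  rw [himg, Set.InjOn.ncard_image ((flatten_replicate_injOn hc d).mono fun u hu => hu.1)]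
  rcases Nat.even_or_odd c with h | h
  · have : {u : List (Fin 3) | u.length = d ∧ Even (c * letterSum u)} = {u | u.length = d} := by
      ext u; simp [h.mul_right]
    rw [this, ncard_words, oddIndicator_of_even h]
    push_cast; ring
  · have : {u : List (Fin 3) | u.length = d ∧ Even (c * letterSum u)} =
        {u | u.length = d ∧ Even (letterSum u)} := by
      ext u; simp [Nat.even_mul, Nat.not_even_iff_odd.2 h]
    rw [this, ncard_even_words, oddIndicator_of_odd h]
    ring

theorem rotate_eq_iterate_rotate_one {α : Type*} (l : List α) (k : ℕ) :
    (fun l : List α => l.rotate 1)^[k] l = l.rotate k := by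
  induction k with
  | zero => simp
  | succ k ih => rw [Function.iterate_succ_apply', ih, List.rotate_rotate]

theorem rotate_eq_self_iff_gcd {α : Type*} (l : List α) (k : ℕ) :
    l.rotate k = l ↔ l.rotate (l.length.gcd k) = l := by
  have hp : ∀ m, Function.IsPeriodicPt (fun l : List α => l.rotate 1) m l ↔ l.rotate m = l :=
    fun m => by rw [Function.IsPeriodicPt, Function.IsFixedPt, rotate_eq_iterate_rotate_one]
  rw [← hp, ← hp]
  refine ⟨fun h => Function.IsPeriodicPt.gcd ((hp _).2 (List.rotate_length l)) h, fun h => ?_⟩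
  exact h.trans_dvd (Nat.gcd_dvd_right _ _)

/-- The ternary words of length `n` with an even sum of letters. -/
abbrev EvenWord (n : ℕ) := {l : List (Fin 3) // l.length = n ∧ Even (letterSum l)}

/-- `ZMod n` acts on the words of length `n` by rotation. -/
instance evenWordRotation (n : ℕ) [NeZero n] : MulAction (Multiplicative (ZMod n)) (EvenWord n) where
  smul g l := ⟨l.1.rotate g.toAdd.val, by simp [l.2.1], by rw [letterSum_rotate]; exact l.2.2⟩
  one_smul l := Subtype.ext (by
    change l.1.rotate (0 : ZMod n).val = l.1
    simp)
  mul_smul a b l := Subtype.ext (by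
    change l.1.rotate (a.toAdd + b.toAdd).val = (l.1.rotate b.toAdd.val).rotate a.toAdd.val
    have h := List.rotate_mod l.1 (b.toAdd.val + a.toAdd.val)
    rw [l.2.1] at h
    rw [List.rotate_rotate, ZMod.val_add, add_comm a.toAdd.val, h])

theorem evenWord_smul_val (n : ℕ) [NeZero n] (g : Multiplicative (ZMod n)) (l : EvenWord n) :
    (g • l).1 = l.1.rotate g.toAdd.val := rfl

theorem evenTernaryNecklaces_eq_range (n : ℕ) :
    evenTernaryNecklaces n = Set.range fun l : EvenWord n => (l.1 : Cycle (Fin 3)) := by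
  ext w
  obtain ⟨l, rfl⟩ : ∃ l : List (Fin 3), (l : Cycle (Fin 3)) = w := Quotient.exists_rep w
  have hmem : ∀ l : List (Fin 3), (l : Cycle (Fin 3)) ∈ evenTernaryNecklaces n ↔
      l.length = n ∧ Even (letterSum l) := fun _ => Iff.rfl
  constructor
  · intro h; exact ⟨⟨l, (hmem l).1 h⟩, rfl⟩
  · rintro ⟨⟨l', h⟩, hl⟩
    rw [← hl]
    exact (hmem l').2 h

theorem coe_cycle_eq_iff_orbitRel (n : ℕ) [NeZero n] (l l' : EvenWord n) :
    (l.1 : Cycle (Fin 3)) = (l'.1 : Cycle (Fin 3)) ↔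
      MulAction.orbitRel (Multiplicative (ZMod n)) (EvenWord n) l l' := by
  rw [Cycle.coe_eq_coe, MulAction.orbitRel_apply, List.isRotated_comm]
  constructor
  · rintro ⟨k, hk⟩
    refine ⟨Multiplicative.ofAdd (k : ZMod n), Subtype.ext ?_⟩
    have h := List.rotate_mod l'.1 k
    rw [l'.2.1] at h
    simp only [evenWord_smul_val, toAdd_ofAdd, ZMod.val_natCast, h, hk]
  · rintro ⟨g, hg⟩
    exact ⟨g.toAdd.val, by rw [← hg]; rfl⟩

/-- Burnside's lemma for the rotation action of `ZMod n`. -/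
theorem mul_ncard_evenTernaryNecklaces (n : ℕ) [NeZero n] :
    (n : ℚ) * (evenTernaryNecklaces n).ncard =
      ∑ k ∈ Finset.range n, ({l : List (Fin 3) |
        (l.length = n ∧ Even (letterSum l)) ∧ l.rotate (n.gcd k) = l}.ncard : ℚ) := by
  classical
  have hfin : Finite (EvenWord n) := ((finite_words n).subset fun l h => h.1 :
    {l : List (Fin 3) | l.length = n ∧ Even (letterSum l)}.Finite).to_subtype
  have := Fintype.ofFinite (EvenWord n)
  have hB := MulAction.sum_card_fixedBy_eq_card_orbits_mul_card_group
    (Multiplicative (ZMod n)) (EvenWord n)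
  have hcard : (evenTernaryNecklaces n).ncard =
      Fintype.card (Quotient (MulAction.orbitRel (Multiplicative (ZMod n)) (EvenWord n))) := by
    rw [evenTernaryNecklaces_eq_range]
    let h : Quotient (MulAction.orbitRel (Multiplicative (ZMod n)) (EvenWord n)) →
        Cycle (Fin 3) := Quotient.lift (fun l : EvenWord n => (l.1 : Cycle (Fin 3)))
      fun l l' hl => (coe_cycle_eq_iff_orbitRel n l l').2 hl
    have hinj : Function.Injective h := by
      intro a b
      refine Quotient.inductionOn₂' a b fun l l' hl => ?_
      exact Quotient.sound' ((coe_cycle_eq_iff_orbitRel n l l').1 hl)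
    have hr : (Set.range fun l : EvenWord n => (l.1 : Cycle (Fin 3))) = Set.range h :=
      by
      ext w
      exact ⟨fun ⟨l, hl⟩ => ⟨Quotient.mk'' l, hl⟩,
        fun ⟨q, hq⟩ => by
          obtain ⟨l, rfl⟩ := Quotient.exists_rep q
          exact ⟨l, hq⟩⟩
    rw [hr, ← Nat.card_coe_set_eq, Nat.card_range_of_injective hinj, Nat.card_eq_fintype_card]
  rw [hcard]
  have hG : Fintype.card (Multiplicative (ZMod n)) = n := by
    rw [Fintype.card_multiplicative, ZMod.card]
  rw [hG] at hB
  have hB' := congrArg (Nat.cast : ℕ → ℚ) hB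
  push_cast at hB'
  rw [mul_comm, ← hB']
  refine Finset.sum_bij (fun g _ => g.toAdd.val) (fun g _ => Finset.mem_range.2 (ZMod.val_lt _))
    (fun a _ b _ h => Multiplicative.toAdd.injective (ZMod.val_injective n h))
    (fun k hk => ⟨Multiplicative.ofAdd (k : ZMod n), Finset.mem_univ _, by
      simp [ZMod.val_natCast, Nat.mod_eq_of_lt (Finset.mem_range.1 hk)]⟩) ?_
  intro g _
  rw [← Nat.card_eq_fintype_card, Nat.card_coe_set_eq, ← Set.ncard_image_of_injective _
    (Subtype.val_injective)]
  congr 2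
  ext l
  simp only [Set.mem_image, Set.mem_ofPred_eq, MulAction.mem_fixedBy]
  constructor
  · rintro ⟨⟨l, hl⟩, h, rfl⟩
    refine ⟨hl, ?_⟩
    have := congrArg Subtype.val h
    rw [evenWord_smul_val, rotate_eq_self_iff_gcd, hl.1] at this
    exact this
  · rintro ⟨hl, h⟩
    refine ⟨⟨l, hl⟩, Subtype.ext ?_, rfl⟩
    rw [evenWord_smul_val, rotate_eq_self_iff_gcd]
    simpa only [hl.1] using h

theorem ncard_evenTernaryNecklaces {n : ℕ} (hn : n ≠ 0) :
    ((evenTernaryNecklaces n).ncard : ℚ) = ∑ d ∈ n.divisors, cubicLyndon d := by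
  have : NeZero n := ⟨hn⟩
  have hn' : (n : ℚ) ≠ 0 := by exact_mod_cast hn
  refine mul_left_cancel₀ hn' ?_
  rw [mul_ncard_evenTernaryNecklaces, sum_divisors_cubicLyndon]
  have hmaps : ∀ k ∈ Finset.range n, ((n / n.gcd k, n.gcd k) : ℕ × ℕ) ∈
      n.divisorsAntidiagonal := fun k _ =>
    Nat.mem_divisorsAntidiagonal.2 ⟨Nat.div_mul_cancel (Nat.gcd_dvd_left n k), hn⟩
  rw [← Finset.sum_fiberwise_of_maps_to hmaps]
  refine Finset.sum_congr rfl fun p hp => ?_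
  obtain ⟨hp, -⟩ := Nat.mem_divisorsAntidiagonal.1 hp
  have hp1 : p.1 ≠ 0 := fun h => hn (by rw [← hp, h, zero_mul])
  have hp2 : p.2 ≠ 0 := fun h => hn (by rw [← hp, h, mul_zero])
  have hset : (Finset.range n).filter (fun k => ((n / n.gcd k, n.gcd k) : ℕ × ℕ) = p) =
      (Finset.range n).filter fun k => n.gcd k = p.2 := by
    refine Finset.filter_congr fun k _ => ⟨fun h => congrArg Prod.snd h, fun h => ?_⟩
    refine Prod.ext ?_ h
    simp only [h]
    rw [← hp]; exact Nat.mul_div_cancel _ (Nat.pos_of_ne_zero hp2)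
  -- Rotations with the same `gcd(n, k) = d` have the same fixed words, and there are `φ(n/d)` of
  -- them.
  have htot : ((Finset.range n).filter fun k => n.gcd k = p.2).card = Nat.totient p.1 := by
    rw [← Nat.totient_div_of_dvd ⟨p.1, by rw [← hp, mul_comm]⟩, ← hp,
      Nat.mul_div_cancel _ (Nat.pos_of_ne_zero hp2)]
  rw [hset, ← htot, ← nsmul_eq_mul]
  refine Finset.sum_eq_card_nsmul fun k hk => ?_
  rw [(Finset.mem_filter.1 hk).2, ← ncard_even_rotate_eq_self hp1, hp]

/-! ### The cubic map over a commutative ring -/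

section CubicRing

open Function

variable {A B : Type*} [CommRing A] [CommRing B]

/-- The cubic map `x ↦ ρ x - x³` over a commutative ring. -/
def cubic (ρ x : A) : A := ρ * x - x ^ 3

/-- The derivative of the `n`-th iterate of the cubic map at `x`. -/
def cubicDeriv (n : ℕ) (ρ x : A) : A := ∏ k ∈ Finset.range n, (ρ - 3 * ((cubic ρ)^[k] x) ^ 2)

theorem cubicMap_eq_cubic (r : ℂ) : cubicMap r = cubic r := rfl

theorem cubicMultiplier_eq_cubicDeriv (n : ℕ) (r x : ℂ) :
    cubicMultiplier n r x = cubicDeriv n r x := by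
  refine Finset.prod_congr rfl fun k _ => ?_
  rw [cubicMap_eq_cubic]
  generalize (cubic r)^[k] x = y
  have h : HasDerivAt (cubic r) (r * 1 - ((3 : ℕ) : ℂ) * y ^ (3 - 1)) y :=
    ((hasDerivAt_id y).const_mul r).sub (hasDerivAt_pow 3 y)
  rw [h.deriv]
  norm_num

theorem cubic_neg (ρ x : A) : cubic ρ (-x) = -cubic ρ x := by
  simp only [cubic]; ring

theorem map_cubic_iterate (φ : A →+* B) (n : ℕ) (ρ x : A) :
    φ ((cubic ρ)^[n] x) = (cubic (φ ρ))^[n] (φ x) := by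
  have h : Semiconj φ (cubic ρ) (cubic (φ ρ)) := fun x => by simp [cubic]
  exact (h.iterate_right n) x

theorem map_cubicDeriv (φ : A →+* B) (n : ℕ) (ρ x : A) :
    φ (cubicDeriv n ρ x) = cubicDeriv n (φ ρ) (φ x) := by
  simp [cubicDeriv, map_prod, map_cubic_iterate, map_ofNat]

theorem cubicDeriv_neg (n : ℕ) (ρ x : A) : cubicDeriv n ρ (-x) = cubicDeriv n ρ x := by
  refine Finset.prod_congr rfl fun k _ => ?_
  rw [iterate_neg_of_odd (cubic_neg ρ), neg_sq]

theorem cubicDeriv_apply {n : ℕ} {ρ x : A} (h : (cubic ρ)^[n] x = x) :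
    cubicDeriv n ρ (cubic ρ x) = cubicDeriv n ρ x := by
  cases n with
  | zero => rfl
  | succ n =>
    simp only [cubicDeriv, ← iterate_succ_apply]
    rw [Finset.prod_range_succ, Finset.prod_range_succ' _ n, h]
    rfl

theorem cubicDeriv_iterate {n : ℕ} {ρ x : A} (h : (cubic ρ)^[n] x = x) (j : ℕ) :
    cubicDeriv n ρ ((cubic ρ)^[j] x) = cubicDeriv n ρ x := by
  induction j with
  | zero => rfl
  | succ j ih =>
    rw [iterate_succ_apply', cubicDeriv_apply, ih]
    rw [← iterate_add_apply, add_comm, iterate_add_apply, h]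

/-- The monic polynomial `(-1)ⁿ fⁿ(X)` for the cubic map `f`. -/
def cubicIterPoly (ρ : A) : ℕ → A[X]
  | 0 => X
  | n + 1 => cubicIterPoly ρ n ^ 3 - C ρ * cubicIterPoly ρ n

theorem eval_cubicIterPoly (ρ x : A) (n : ℕ) :
    (cubicIterPoly ρ n).eval x = (-1) ^ n * (cubic ρ)^[n] x := by
  induction n with
  | zero => simp [cubicIterPoly]
  | succ n ih =>
    simp only [cubicIterPoly, eval_sub, eval_pow, eval_mul, eval_C, ih, iterate_succ_apply']
    have h : ((-1 : A) ^ n) ^ 3 = (-1) ^ n := by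
      rw [← pow_mul, mul_comm, pow_mul]; norm_num
    rw [mul_pow, h, cubic]
    ring

theorem eval_derivative_cubicIterPoly (ρ x : A) (n : ℕ) :
    (derivative (cubicIterPoly ρ n)).eval x = (-1) ^ n * cubicDeriv n ρ x := by
  induction n with
  | zero => simp [cubicIterPoly, cubicDeriv]
  | succ n ih =>
    have h : ((-1 : A) ^ n) ^ 2 = 1 := by
      rw [← pow_mul, mul_comm, pow_mul]; norm_num
    have h2 : cubicDeriv (n + 1) ρ x =
        cubicDeriv n ρ x * (ρ - 3 * ((cubic ρ)^[n] x) ^ 2) := Finset.prod_range_succ _ _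
    simp only [cubicIterPoly, derivative_sub, derivative_mul, derivative_C, zero_mul, zero_add,
      derivative_pow, eval_sub, eval_mul, eval_pow, eval_C, ih, eval_cubicIterPoly, h2]
    rw [Nat.add_one_sub_one, mul_pow, h]
    push_cast
    ring

theorem cubicIterPoly_monic_natDegree [Nontrivial A] (ρ : A) (n : ℕ) :
    (cubicIterPoly ρ n).Monic ∧ (cubicIterPoly ρ n).natDegree = 3 ^ n := by
  induction n with
  | zero => exact ⟨monic_X, natDegree_X⟩
  | succ n ih =>
    have hd : (cubicIterPoly ρ n ^ 3).natDegree = 3 ^ (n + 1) := by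
      rw [ih.1.natDegree_pow, ih.2, pow_succ, mul_comm]
    have hlt : (C ρ * cubicIterPoly ρ n).natDegree < (cubicIterPoly ρ n ^ 3).natDegree := by
      rw [hd]
      refine (natDegree_C_mul_le _ _).trans_lt ?_
      rw [ih.2]
      exact Nat.pow_lt_pow_right (by norm_num) (Nat.lt_succ_self n)
    refine ⟨(ih.1.pow 3).sub_of_left (degree_lt_degree hlt), ?_⟩
    rw [cubicIterPoly, natDegree_sub_eq_left_of_natDegree_lt hlt, hd]

/-- The monic polynomial whose roots are the solutions of `fⁿ(x) = ε x`. -/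
def cubicPerPoly (ρ : A) (n : ℕ) (ε : A) : A[X] := cubicIterPoly ρ n - C ((-1) ^ n * ε) * X

theorem cubicPerPoly_monic_natDegree [Nontrivial A] (ρ : A) {n : ℕ} (hn : n ≠ 0) (ε : A) :
    (cubicPerPoly ρ n ε).Monic ∧ (cubicPerPoly ρ n ε).natDegree = 3 ^ n := by
  obtain ⟨hm, hd⟩ := cubicIterPoly_monic_natDegree ρ n
  have hlt : (C ((-1) ^ n * ε) * X : A[X]).natDegree < (cubicIterPoly ρ n).natDegree := by
    refine (natDegree_C_mul_le _ _).trans_lt ?_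
    rw [natDegree_X, hd]
    exact Nat.one_lt_pow hn (by norm_num)
  exact ⟨hm.sub_of_left (degree_lt_degree hlt), by
    rw [cubicPerPoly, natDegree_sub_eq_left_of_natDegree_lt hlt, hd]⟩

theorem eval_cubicPerPoly (ρ x : A) (n : ℕ) (ε : A) :
    (cubicPerPoly ρ n ε).eval x = (-1) ^ n * ((cubic ρ)^[n] x - ε * x) := by
  simp only [cubicPerPoly, eval_sub, eval_cubicIterPoly, eval_mul, eval_C, eval_X]
  ring

theorem isRoot_cubicPerPoly (ρ x : A) (n : ℕ) (ε : A) :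
    (cubicPerPoly ρ n ε).IsRoot x ↔ (cubic ρ)^[n] x = ε * x := by
  rw [IsRoot.def, eval_cubicPerPoly, ((isUnit_one.neg).pow n).mul_right_eq_zero, sub_eq_zero]

theorem eval_derivative_cubicPerPoly (ρ x : A) (n : ℕ) (ε : A) :
    (derivative (cubicPerPoly ρ n ε)).eval x = (-1) ^ n * (cubicDeriv n ρ x - ε) := by
  simp only [cubicPerPoly, derivative_sub, derivative_C_mul, derivative_X, mul_one, eval_sub,
    eval_derivative_cubicIterPoly, eval_C]
  ring

theorem map_cubicPerPoly (φ : A →+* B) (ρ : A) (n : ℕ) (ε : A) :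
    (cubicPerPoly ρ n ε).map φ = cubicPerPoly (φ ρ) n (φ ε) := by
  have h : (cubicIterPoly ρ n).map φ = cubicIterPoly (φ ρ) n := by
    induction n with
    | zero => simp [cubicIterPoly]
    | succ n ih => simp [cubicIterPoly, ih]
  simp [cubicPerPoly, h]

/-- Two distinct roots of a polynomial that agree after a ring homomorphism yield a multiple
root. -/
theorem eval_map_derivative_eq_zero_of_roots [IsDomain A] (φ : A →+* B) {p : A[X]} {a b : A}
    (hab : a ≠ b) (ha : p.IsRoot a) (hb : p.IsRoot b) (h : φ a = φ b) :
    (derivative (p.map φ)).eval (φ a) = 0 := by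
  obtain ⟨q, rfl⟩ := dvd_iff_isRoot.2 ha
  have hq : q.eval b = 0 := by
    have : (b - a) * q.eval b = 0 := by simpa using hb
    exact (mul_eq_zero.1 this).resolve_left (sub_ne_zero.2 hab.symm)
  have hq' : (q.map φ).eval (φ a) = 0 := by rw [h, eval_map_apply, hq, map_zero]
  simp [derivative_mul, hq']

end CubicRing

/-! ### Large parameters -/

section LargeParameter

open Function

theorem norm_lt_norm_cubic {r x : ℂ} (h : ‖r‖ + 1 < ‖x‖ ^ 2) : ‖x‖ < ‖cubic r x‖ := by
  have hx : 0 < ‖x‖ := by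
    rcases (norm_nonneg x).eq_or_lt with h0 | h0
    · rw [← h0] at h; nlinarith [norm_nonneg r]
    · exact h0
  have h1 : cubic r x = x * (r - x ^ 2) := by simp only [cubic]; ring
  have h2 : ‖x‖ ^ 2 - ‖r‖ ≤ ‖r - x ^ 2‖ := by
    rw [← norm_pow, norm_sub_rev]; exact norm_sub_norm_le _ _
  rw [h1, norm_mul]
  nlinarith

/-- Beyond this radius the norm increases strictly along the orbit, so the orbit cannot return. -/
theorem norm_sq_le_of_periodic {r x : ℂ} {n : ℕ} (hn : n ≠ 0) (h : (cubic r)^[n] x = x) :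
    ‖x‖ ^ 2 ≤ ‖r‖ + 1 := by
  by_contra! hlt
  have key : ∀ k, ‖x‖ ≤ ‖(cubic r)^[k] x‖ ∧ (k ≠ 0 → ‖x‖ < ‖(cubic r)^[k] x‖) := by
    intro k
    induction k with
    | zero => simp
    | succ k ih =>
      have h1 : ‖r‖ + 1 < ‖(cubic r)^[k] x‖ ^ 2 :=
        hlt.trans_le (pow_le_pow_left₀ (norm_nonneg _) ih.1 2)
      have h2 := ih.1.trans_lt (norm_lt_norm_cubic h1)
      rw [iterate_succ_apply']
      exact ⟨h2.le, fun _ => h2⟩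
  have := (key n).2 hn
  rw [h] at this
  exact lt_irrefl _ this

/-- Either `x` is so small that `r` dominates `3x²`, or a small image `x (r - x²)` forces `x²` close
to `r`, and then `r - 3x²` is close to `-2r`. -/
theorem half_norm_le_of_norm_cubic_le {r x : ℂ} (hr : 100 ≤ ‖r‖)
    (h : ‖cubic r x‖ ^ 2 ≤ ‖r‖ + 1) : ‖r‖ / 2 ≤ ‖r - 3 * x ^ 2‖ := by
  rcases le_or_gt (6 * ‖x‖ ^ 2) ‖r‖ with hx | hx
  · have h1 : ‖r‖ - ‖3 * x ^ 2‖ ≤ ‖r - 3 * x ^ 2‖ := norm_sub_norm_le _ _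
    have h2 : ‖3 * x ^ 2‖ = 3 * ‖x‖ ^ 2 := by simp
    linarith
  · have h1 : cubic r x = x * (r - x ^ 2) := by simp only [cubic]; ring
    rw [h1, norm_mul, mul_pow] at h
    have h4 : ‖r - x ^ 2‖ ≤ 4 := by
      by_contra! h5
      have h6 : (16 : ℝ) < ‖r - x ^ 2‖ ^ 2 := by nlinarith
      nlinarith
    have h7 : r - 3 * x ^ 2 = 3 * (r - x ^ 2) - 2 * r := by ring
    have h8 : ‖2 * r‖ - ‖3 * (r - x ^ 2)‖ ≤ ‖r - 3 * x ^ 2‖ := by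
      rw [h7, norm_sub_rev]; exact norm_sub_norm_le _ _
    have h9 : ‖2 * r‖ = 2 * ‖r‖ := by simp
    have h10 : ‖3 * (r - x ^ 2)‖ = 3 * ‖r - x ^ 2‖ := by simp
    linarith

/-- For large parameters all cycles are repelling. -/
theorem half_norm_le_norm_cubicDeriv {r x : ℂ} {m n : ℕ} (hr : 100 ≤ ‖r‖) (hm : m ≠ 0)
    (h : (cubic r)^[m] x = x) (hn : n ≠ 0) : ‖r‖ / 2 ≤ ‖cubicDeriv n r x‖ := by
  have h1 : ∀ k, ‖r‖ / 2 ≤ ‖r - 3 * ((cubic r)^[k] x) ^ 2‖ := by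
    intro k
    refine half_norm_le_of_norm_cubic_le hr (norm_sq_le_of_periodic hm ?_)
    rw [← iterate_succ_apply' (cubic r), ← iterate_add_apply, add_comm, iterate_add_apply, h]
  obtain ⟨n, rfl⟩ := Nat.exists_eq_succ_of_ne_zero hn
  rw [cubicDeriv, norm_prod]
  clear hn
  induction n with
  | zero => simpa using h1 0
  | succ n ih =>
    rw [Finset.prod_range_succ]
    -- Each further factor has norm at least `50`, so it does not lower the bound.
    nlinarith [h1 (n + 1)]

end LargeParameter

/-! ### The integral closure of `ℂ[X]` in an algebraic closure of its fraction field -/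

/-- An algebraic closure of the field of rational functions in the parameter. -/
abbrev ParamField : Type := AlgebraicClosure (FractionRing ℂ[X])

/-- The ring of algebraic functions of the parameter that are integral over `ℂ[X]`. -/
abbrev ParamRing : Type := integralClosure ℂ[X] ParamField

/-- The parameter as an element of `ParamRing`. -/
def param : ParamRing := algebraMap ℂ[X] ParamRing X

theorem algebraMap_paramRing_injective : Function.Injective (algebraMap ℂ[X] ParamRing) := by
  intro a b h
  have h' : algebraMap ℂ[X] ParamField a = algebraMap ℂ[X] ParamField b :=
    congrArg Subtype.val h
  rw [IsScalarTower.algebraMap_apply ℂ[X] (FractionRing ℂ[X]) ParamField,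
    IsScalarTower.algebraMap_apply ℂ[X] (FractionRing ℂ[X]) ParamField] at h'
  exact IsFractionRing.injective ℂ[X] (FractionRing ℂ[X])
    ((algebraMap (FractionRing ℂ[X]) ParamField).injective h')

/-- Roots in `ParamField` are integral over `ParamRing`, hence over `ℂ[X]` by transitivity. -/
theorem splits_of_monic_paramRing {p : ParamRing[X]} (hp : p.Monic) : p.Splits := by
  refine Splits.of_splits_map_of_injective (i := algebraMap ParamRing ParamField)
    Subtype.val_injective (IsAlgClosed.splits _) fun a ha => ?_
  have h1 : IsIntegral ParamRing a := ⟨p, hp, by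
    have := (mem_roots'.1 ha).2
    rwa [IsRoot.def, eval_map] at this⟩
  have h2 : IsIntegral ℂ[X] a := isIntegral_trans a h1
  exact ⟨⟨a, h2⟩, rfl⟩

/-- A maximal ideal of an integral extension of `ℂ[X]` over `X - r` is the kernel of a
specialization at the parameter `r`. -/
theorem exists_specialization_of_isMaximal {B : Type*} [CommRing B] [Algebra ℂ[X] B]
    [Algebra.IsIntegral ℂ[X] B] (m : Ideal B) (hm : m.IsMaximal) (r : ℂ)
    (hr : algebraMap ℂ[X] B (X - C r) ∈ m) :
    ∃ φ : B →+* ℂ, (∀ a : ℂ[X], φ (algebraMap ℂ[X] B a) = a.eval r) ∧ ∀ t ∈ m, φ t = 0 := by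
  let π : B →+* B ⧸ m := Ideal.Quotient.mk m
  have : Field (B ⧸ m) := Ideal.Quotient.field m
  let i : ℂ →+* B ⧸ m := (π.comp (algebraMap ℂ[X] B)).comp C
  have hi : π.comp (algebraMap ℂ[X] B) = i.comp (evalRingHom r) := by
    refine Polynomial.ringHom_ext (fun a => by simp [i]) ?_
    have h := Ideal.Quotient.eq_zero_iff_mem.2 hr
    rw [map_sub, map_sub, sub_eq_zero] at h
    change π (algebraMap ℂ[X] B X) = π (algebraMap ℂ[X] B (C (eval r X)))
    rw [eval_X]
    exact h
  -- The residue field is integral over the algebraically closed field `ℂ`, hence equal to it.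
  have hint : i.IsIntegral := by
    intro y
    obtain ⟨b, rfl⟩ := Ideal.Quotient.mk_surjective y
    obtain ⟨q, hq, hq0⟩ := Algebra.IsIntegral.isIntegral (R := ℂ[X]) b
    refine ⟨q.map (evalRingHom r), hq.map _, ?_⟩
    rw [eval₂_map, ← hi, ← hom_eval₂, hq0, map_zero]
  have : IsDomain (B ⧸ m) := Ideal.Quotient.isDomain m
  have hbij := IsAlgClosed.ringHom_bijective_of_isIntegral i hint
  let e := (RingEquiv.ofBijective i hbij).symm
  refine ⟨(e : B ⧸ m →+* ℂ).comp π, fun a => ?_, fun t ht => ?_⟩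
  · have h : π (algebraMap ℂ[X] B a) = i (a.eval r) := RingHom.congr_fun hi a
    change e (π (algebraMap ℂ[X] B a)) = _
    rw [h]
    exact (RingEquiv.ofBijective i hbij).symm_apply_apply _
  · have h : π t = 0 := Ideal.Quotient.eq_zero_iff_mem.2 ht
    change e (π t) = 0
    rw [h, map_zero]

/-- Lying over, applied to the ideal of polynomials vanishing at `r`. -/
theorem exists_specialization (r : ℂ) :
    ∃ φ : ParamRing →+* ℂ, ∀ a : ℂ[X], φ (algebraMap ℂ[X] ParamRing a) = a.eval r := by
  have hmax : (RingHom.ker (evalRingHom r)).IsMaximal :=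
    RingHom.ker_isMaximal_of_surjective _ fun c => ⟨C c, by simp⟩
  obtain ⟨Q, hQ, hQc⟩ := Ideal.exists_ideal_over_maximal_of_isIntegral (S := ParamRing)
    (RingHom.ker (evalRingHom r)) (by
      rw [(RingHom.injective_iff_ker_eq_bot _).1 algebraMap_paramRing_injective]; exact bot_le)
  obtain ⟨φ, hφ, -⟩ := exists_specialization_of_isMaximal Q hQ r (by
    rw [← Ideal.mem_comap, hQc, RingHom.mem_ker]; simp)
  exact ⟨φ, hφ⟩

/-- A nonunit of `ParamRing` other than `0` vanishes at some specialization. -/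
theorem exists_specialization_eq_zero {t : ParamRing} (ht : ¬ IsUnit t) (ht0 : t ≠ 0) :
    ∃ φ : ParamRing →+* ℂ, φ t = 0 := by
  obtain ⟨m, hm, htm⟩ := exists_max_ideal_of_mem_nonunits ht
  -- By integrality the prime `m` contains a nonzero polynomial in the parameter; this splits over
  -- `ℂ`, so `m` contains some `X - r`.
  have hne : m.comap (algebraMap ℂ[X] ParamRing) ≠ ⊥ :=
    Ideal.IsIntegral.comap_ne_bot ℂ[X] fun h => ht0 (by rwa [h, Ideal.mem_bot] at htm)
  obtain ⟨a, ha, ha0⟩ := Submodule.exists_mem_ne_zero_of_ne_bot hne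
  have hprime : (m.comap (algebraMap ℂ[X] ParamRing)).IsPrime := hm.isPrime.comap _
  have hs := (IsAlgClosed.splits a).eq_prod_roots
  obtain ⟨r, hr⟩ : ∃ r, (X - C r) ∈ m.comap (algebraMap ℂ[X] ParamRing) := by
    rw [hs] at ha
    rcases hprime.mem_or_mem ha with h | h
    · exfalso
      exact hprime.ne_top (Ideal.eq_top_of_isUnit_mem _ h
        (isUnit_C.2 (isUnit_iff_ne_zero.2 (leadingCoeff_ne_zero.2 ha0))))
    · obtain ⟨b, hb, hbm⟩ := (hprime.multiset_prod_mem_iff_exists_mem _).1 h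
      obtain ⟨r, -, rfl⟩ := Multiset.mem_map.1 hb
      exact ⟨r, hbm⟩
  obtain ⟨φ, -, hφ⟩ := exists_specialization_of_isMaximal m hm r hr
  exact ⟨φ, hφ t htm⟩

/-- A nonzero element of `ParamRing` is nonzero at all specializations outside a finite set of
parameters. -/
theorem exists_finite_of_ne_zero {t : ParamRing} (ht : t ≠ 0) :
    ∃ s : Set ℂ, s.Finite ∧ ∀ r ∉ s, ∀ φ : ParamRing →+* ℂ,
      (∀ a : ℂ[X], φ (algebraMap ℂ[X] ParamRing a) = a.eval r) → φ t ≠ 0 := by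
  -- By integrality `t` divides a nonzero polynomial `a` in the parameter; only the roots of `a` are
  -- exceptional.
  have hne : (Ideal.span {t}).comap (algebraMap ℂ[X] ParamRing) ≠ ⊥ :=
    Ideal.IsIntegral.comap_ne_bot ℂ[X] fun h => ht (Ideal.span_singleton_eq_bot.1 h)
  obtain ⟨a, ha, ha0⟩ := Submodule.exists_mem_ne_zero_of_ne_bot hne
  obtain ⟨u, hu⟩ := Ideal.mem_span_singleton.1 (Ideal.mem_comap.1 ha)
  refine ⟨{r | a.IsRoot r}, finite_setOfPred_isRoot ha0, fun r hr φ hφ h0 => hr ?_⟩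
  change a.eval r = 0
  rw [← hφ, hu, map_mul, h0, zero_mul]

theorem eq_zero_of_specializations {t : ParamRing} {s : Set ℂ} (hs : s.Finite)
    (h : ∀ r ∉ s, ∃ φ : ParamRing →+* ℂ,
      (∀ a : ℂ[X], φ (algebraMap ℂ[X] ParamRing a) = a.eval r) ∧ φ t = 0) : t = 0 := by
  by_contra ht
  obtain ⟨s', hs', h'⟩ := exists_finite_of_ne_zero ht
  obtain ⟨r, hr⟩ := (hs.union hs').exists_notMem
  rw [Set.mem_union, not_or] at hr
  obtain ⟨φ, hφ, hφ0⟩ := h r hr.1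
  exact h' r hr.2 φ hφ hφ0

/-- Automorphisms of `ParamField` restrict to `ParamRing`, so by Galois theory `t` is a rational
function of the parameter; being integral over the integrally closed `ℂ[X]`, it is a polynomial. -/
theorem mem_range_algebraMap_of_fixed {t : ParamRing}
    (ht : ∀ σ : ParamRing ≃ₐ[ℂ[X]] ParamRing, σ t = t) :
    t ∈ Set.range (algebraMap ℂ[X] ParamRing) := by
  have h1 : (t : ParamField) ∈ Set.range (algebraMap (FractionRing ℂ[X]) ParamField) := by
    rw [InfiniteGalois.mem_range_algebraMap_iff_fixed]
    intro σ
    have := algebraMap_galRestrict_apply ℂ[X] (B := ParamRing) σ t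
    rw [ht] at this
    exact this.symm
  obtain ⟨y, hy⟩ := h1
  have hint : IsIntegral ℂ[X] y := by
    refine (isIntegral_algebraMap_iff (B := ParamField)
      (algebraMap (FractionRing ℂ[X]) ParamField).injective).1 ?_
    rw [hy]
    exact t.2
  obtain ⟨a, ha⟩ := IsIntegrallyClosed.isIntegral_iff.1 hint
  refine ⟨a, Subtype.ext ?_⟩
  rw [← hy, ← ha]
  rfl

/-- A polynomial with a Galois stable set of roots has coefficients in `ℂ[X]`. -/
theorem exists_map_eq_prod_X_sub_C (U : Finset ParamRing)
    (hU : ∀ σ : ParamRing ≃ₐ[ℂ[X]] ParamRing, ∀ t ∈ U, σ t ∈ U) :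
    ∃ P : ℂ[X][Y], P.Monic ∧ P.natDegree = U.card ∧
      P.map (algebraMap ℂ[X] ParamRing) = ∏ t ∈ U, (X - C t) := by
  have hlift : (∏ t ∈ U, (X - C t)) ∈ lifts (algebraMap ℂ[X] ParamRing) := by
    rw [lifts_iff_coeff_lifts]
    intro k
    refine mem_range_algebraMap_of_fixed fun σ => ?_
    have hmap : (∏ t ∈ U, (X - C t)).map (σ : ParamRing →+* ParamRing) =
        ∏ t ∈ U, (X - C t) := by
      have himg : U.map σ.toEquiv.toEmbedding = U := by
        refine Finset.eq_of_subset_of_card_le (fun t ht => ?_) (by rw [Finset.card_map])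
        obtain ⟨u, hu, rfl⟩ := Finset.mem_map.1 ht
        exact hU σ u hu
      rw [Polynomial.map_prod]
      conv_rhs => rw [← himg, Finset.prod_map]
      refine Finset.prod_congr rfl fun t _ => ?_
      simp
    conv_rhs => rw [← hmap, coeff_map]
    rfl
  obtain ⟨P, hP, hd, hm⟩ := lifts_and_natDegree_eq_and_monic hlift
    (monic_prod_of_monic _ _ fun t _ => monic_X_sub_C t)
  refine ⟨P, hm, ?_, hP⟩
  rw [hd, natDegree_prod_of_monic _ _ fun t _ => monic_X_sub_C t]
  simp

theorem ncard_isRoot_of_splits {A : Type*} [CommRing A] [IsDomain A] {p : A[X]} (hp : p.Splits)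
    (hp0 : p ≠ 0) (h : ∀ x, p.IsRoot x → (derivative p).eval x ≠ 0) :
    {x | p.IsRoot x}.ncard = p.natDegree := by
  classical
  have hnd : p.roots.Nodup := by
    rw [Multiset.nodup_iff_count_le_one]
    intro x
    rw [count_roots]
    by_contra! hlt
    have := (one_lt_rootMultiplicity_iff_isRoot hp0).1 hlt
    exact h x this.1 this.2
  have hset : {x | p.IsRoot x} = (p.roots.toFinset : Set A) := by
    ext x; simp [hp0]
  rw [hset, Set.ncard_coe_finset, Multiset.toFinset_card_of_nodup hnd,
    ← hp.natDegree_eq_card_roots]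

/-! ### Cycles over `ParamRing` -/

open Function

theorem map_param {φ : ParamRing →+* ℂ} {r : ℂ}
    (hφ : ∀ a : ℂ[X], φ (algebraMap ℂ[X] ParamRing a) = a.eval r) : φ param = r := by
  rw [param, hφ, eval_X]

instance : CharZero ParamRing := (algebraMap ParamRing ParamField).charZero

theorem eq_zero_of_neg_eq_self {A : Type*} [CommRing A] [IsDomain A] [CharZero A] (x : A)
    (h : -x = x) : x = 0 := by
  have h2 : (2 : A) * x = 0 := by linear_combination -h
  exact (mul_eq_zero.1 h2).resolve_left two_ne_zero

theorem isPeriodic_two_mul {A : Type*} [CommRing A] {ρ x ε : A} {n : ℕ} (hε : ε = 1 ∨ ε = -1)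
    (h : (cubic ρ)^[n] x = ε * x) : (cubic ρ)^[2 * n] x = x := by
  rw [two_mul, iterate_add_apply, h]
  rcases hε with rfl | rfl
  · rw [one_mul] at h ⊢; exact h
  · rw [neg_one_mul] at h ⊢
    rw [iterate_neg_of_odd (cubic_neg ρ), h, neg_neg]

/-- At a multiple root the derivative of `fⁿ` would be `ε = ±1`, but specialized to the parameter
`100` it has norm at least `50`. -/
theorem ncard_iterate_eq {n : ℕ} (hn : n ≠ 0) {ε : ℤ} (hε : ε = 1 ∨ ε = -1) :
    {x : ParamRing | (cubic param)^[n] x = ε * x}.ncard = 3 ^ n := by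
  have hm := cubicPerPoly_monic_natDegree param hn (ε : ParamRing)
  rw [← hm.2, ← ncard_isRoot_of_splits (splits_of_monic_paramRing hm.1) hm.1.ne_zero]
  · simp only [isRoot_cubicPerPoly]
  · intro x hx h0
    rw [isRoot_cubicPerPoly] at hx
    rw [eval_derivative_cubicPerPoly, ((isUnit_one.neg).pow n).mul_right_eq_zero,
      sub_eq_zero] at h0
    obtain ⟨φ, hφ⟩ := exists_specialization 100
    have h1 := congrArg φ h0
    rw [map_cubicDeriv, map_param hφ, map_intCast] at h1
    have hε' : (ε : ParamRing) = 1 ∨ (ε : ParamRing) = -1 := by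
      rcases hε with rfl | rfl <;> simp
    have h2 := congrArg φ (isPeriodic_two_mul hε' hx)
    rw [map_cubic_iterate, map_param hφ] at h2
    have h3 := half_norm_le_norm_cubicDeriv (r := 100) (x := φ x) (by norm_num)
      (mul_ne_zero two_ne_zero hn) h2 hn
    rw [h1] at h3
    rcases hε with rfl | rfl <;> norm_num at h3

theorem ncard_periodic {n : ℕ} (hn : n ≠ 0) :
    {x : ParamRing | (cubic param)^[n] x = x}.ncard = 3 ^ n := by
  simpa using ncard_iterate_eq hn (ε := 1) (Or.inl rfl)

theorem ncard_antiperiodic {n : ℕ} (hn : n ≠ 0) :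
    {x : ParamRing | (cubic param)^[n] x = -x}.ncard = 3 ^ n := by
  simpa using ncard_iterate_eq hn (ε := -1) (Or.inr rfl)

theorem finite_periodic {n : ℕ} (hn : n ≠ 0) :
    {x : ParamRing | (cubic param)^[n] x = x}.Finite :=
  Set.finite_of_ncard_pos (by rw [ncard_periodic hn]; positivity)

theorem algEquiv_param (σ : ParamRing ≃ₐ[ℂ[X]] ParamRing) : σ param = param :=
  σ.commutes X

/-- The multiplier of a cycle takes the value `0`: it is not a unit of `ParamRing`. -/
theorem not_isUnit_cubicDeriv {n : ℕ} (hn : n ≠ 0) {x : ParamRing}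
    (hx : (cubic param)^[n] x = x) : ¬ IsUnit (cubicDeriv n param x) := by
  classical
  intro hu
  have hfin : (cubicDeriv n param '' {x : ParamRing | (cubic param)^[n] x = x}).Finite :=
    (finite_periodic hn).image _
  -- The set of unit multipliers is Galois stable; up to sign its product is the polynomial `P.coeff
  -- 0`, which has no zero in `ℂ`.
  set U := hfin.toFinset.filter IsUnit with hU
  have hUm : ∀ t, t ∈ U ↔ (∃ y, (cubic param)^[n] y = y ∧ cubicDeriv n param y = t) ∧ IsUnit t :=
    fun t => by simp [hU]
  have hxU : cubicDeriv n param x ∈ U := (hUm _).2 ⟨⟨x, hx, rfl⟩, hu⟩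
  obtain ⟨P, -, -, hP⟩ := exists_map_eq_prod_X_sub_C U fun σ t ht => by
    obtain ⟨⟨y, hy, rfl⟩, ht⟩ := (hUm t).1 ht
    refine (hUm _).2 ⟨⟨σ y, ?_, ?_⟩, ht.map σ⟩
    · have := map_cubic_iterate (σ : ParamRing →+* ParamRing) n param y
      rw [hy] at this
      simpa [algEquiv_param] using this.symm
    · have := map_cubicDeriv (σ : ParamRing →+* ParamRing) n param y
      simpa [algEquiv_param] using this.symm
  have h0 : algebraMap ℂ[X] ParamRing (P.coeff 0) = ∏ t ∈ U, (-t) := by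
    rw [← coeff_map, hP, coeff_zero_eq_eval_zero, eval_prod]
    simp
  have hval : ∀ r (φ : ParamRing →+* ℂ),
      (∀ a : ℂ[X], φ (algebraMap ℂ[X] ParamRing a) = a.eval r) →
      (P.coeff 0).eval r = ∏ t ∈ U, (-φ t) := by
    intro r φ hφ
    rw [← hφ, h0, map_prod]
    simp
  have hroot : ∀ r, (P.coeff 0).eval r ≠ 0 := by
    intro r
    obtain ⟨φ, hφ⟩ := exists_specialization r
    rw [hval r φ hφ, Finset.prod_ne_zero_iff]
    intro t ht
    exact neg_ne_zero.2 (((hUm t).1 ht).2.map φ).ne_zero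
  obtain ⟨c, hc⟩ : ∃ c, P.coeff 0 = C c := by
    by_contra hne
    have hd : (P.coeff 0).degree ≠ 0 := fun h => hne ⟨_, eq_C_of_degree_eq_zero h⟩
    obtain ⟨r, hr⟩ := IsAlgClosed.exists_root _ hd
    exact hroot r hr
  -- Chosen so that `s ≥ 100` and `s / 2 > ‖c‖`.
  let s : ℝ := 100 + 2 * ‖c‖
  have hs : ‖(s : ℂ)‖ = s := by
    rw [Complex.norm_real, Real.norm_of_nonneg]
    positivity
  have hs100 : 100 ≤ ‖(s : ℂ)‖ := by
    rw [hs]; simp only [s]; linarith [norm_nonneg c]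
  obtain ⟨φ, hφ⟩ := exists_specialization (s : ℂ)
  have hge : ∀ t ∈ U, ‖(s : ℂ)‖ / 2 ≤ ‖-φ t‖ := by
    intro t ht
    obtain ⟨⟨y, hy, rfl⟩, -⟩ := (hUm t).1 ht
    have h1 := congrArg φ hy
    rw [map_cubic_iterate, map_param hφ] at h1
    rw [norm_neg, map_cubicDeriv, map_param hφ]
    exact half_norm_le_norm_cubicDeriv hs100 hn h1 hn
  have h1 : ‖c‖ = ∏ t ∈ U, ‖-φ t‖ := by
    rw [← norm_prod, ← hval _ φ hφ, hc, eval_C]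
  -- One factor alone exceeds `‖c‖`, and the others are at least `1`.
  have h2 : ∏ t ∈ U, (if t = cubicDeriv n param x then ‖(s : ℂ)‖ / 2 else 1) ≤
      ∏ t ∈ U, ‖-φ t‖ := by
    refine Finset.prod_le_prod (fun t _ => by split_ifs <;> positivity) fun t ht => ?_
    split_ifs
    · exact hge t ht
    · linarith [hge t ht]
  rw [Finset.prod_ite_eq' , if_pos hxU, ← h1, hs] at h2
  simp only [s] at h2
  linarith

/-- Colliding periodic points specialize to a multiple root of `fⁿ(z) - z`, where the multiplier is
`1` and not `0`. -/
theorem map_injOn_periodic_of_cubicDeriv_eq_zero {A B : Type*} [CommRing A] [IsDomain A]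
    [CommRing B] [Nontrivial B] (φ : A →+* B) {n : ℕ} {ρ x y : A} (hx : (cubic ρ)^[n] x = x)
    (hy : (cubic ρ)^[n] y = y) (h0 : φ (cubicDeriv n ρ x) = 0) (h : φ x = φ y) : x = y := by
  by_contra hne
  have hroot : ∀ z, (cubic ρ)^[n] z = z → (cubicPerPoly ρ n 1).IsRoot z := fun z hz => by
    rw [isRoot_cubicPerPoly, one_mul, hz]
  have h1 := eval_map_derivative_eq_zero_of_roots φ hne (hroot x hx) (hroot y hy) h
  rw [map_cubicPerPoly, eval_derivative_cubicPerPoly, ← map_cubicDeriv, h0, map_one, zero_sub,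
    ((isUnit_one.neg).pow n).mul_right_eq_zero, neg_eq_zero] at h1
  exact one_ne_zero h1

/-- The multiplier determines a cycle over `ParamRing` up to sign: at a parameter where the
multiplier vanishes the cycles pass through one of the two critical points, which differ by
sign. -/
theorem cubicDeriv_eq_iff {n : ℕ} (hn : n ≠ 0) {x y : ParamRing} (hx : (cubic param)^[n] x = x)
    (hy : (cubic param)^[n] y = y) :
    cubicDeriv n param x = cubicDeriv n param y ↔
      ∃ j, y = (cubic param)^[j] x ∨ y = -(cubic param)^[j] x := by
  constructor
  swap
  · rintro ⟨j, rfl | rfl⟩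
    · rw [cubicDeriv_iterate hx]
    · rw [cubicDeriv_neg, cubicDeriv_iterate hx]
  intro h
  have hit : ∀ z : ParamRing, (cubic param)^[n] z = z → ∀ k,
      (cubic param)^[n] ((cubic param)^[k] z) = (cubic param)^[k] z := fun z hz k => by
    rw [← iterate_add_apply, add_comm, iterate_add_apply, hz]
  obtain ⟨φ, hφ⟩ : ∃ φ : ParamRing →+* ℂ, φ (cubicDeriv n param x) = 0 := by
    by_cases h0 : cubicDeriv n param x = 0
    · obtain ⟨φ, -⟩ := exists_specialization 0
      exact ⟨φ, by rw [h0, map_zero]⟩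
    · exact exists_specialization_eq_zero (not_isUnit_cubicDeriv hn hx) h0
  have hcrit : ∀ z : ParamRing, φ (cubicDeriv n param z) = 0 →
      ∃ k < n, φ param = 3 * φ ((cubic param)^[k] z) ^ 2 := by
    intro z hz
    rw [cubicDeriv, map_prod, Finset.prod_eq_zero_iff] at hz
    obtain ⟨k, hk, hk0⟩ := hz
    refine ⟨k, Finset.mem_range.1 hk, ?_⟩
    rwa [map_sub, map_mul, map_pow, map_ofNat, sub_eq_zero] at hk0
  obtain ⟨k, hk, hk'⟩ := hcrit x hφ
  obtain ⟨i, hi, hi'⟩ := hcrit y (by rw [← h, hφ])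
  -- Both points specialize to critical points, that is, to square roots of `r/3`.
  have hsq : φ ((cubic param)^[k] x) ^ 2 = φ ((cubic param)^[i] y) ^ 2 := by
    have : (3 : ℂ) * φ ((cubic param)^[k] x) ^ 2 = 3 * φ ((cubic param)^[i] y) ^ 2 := by
      rw [← hk', hi']
    exact mul_left_cancel₀ three_ne_zero this
  have hk0 : φ (cubicDeriv n param ((cubic param)^[k] x)) = 0 := by
    rw [cubicDeriv_iterate hx, hφ]
  have hback : (cubic param)^[n - i] ((cubic param)^[i] y) = y := by
    rw [← iterate_add_apply, Nat.sub_add_cancel hi.le, hy]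
  -- Go `k` steps from `x` to the point over the critical point, then `n - i` steps to complete the
  -- cycle of `y`.
  refine ⟨n - i + k, ?_⟩
  rcases sq_eq_sq_iff_eq_or_eq_neg.1 hsq with h1 | h1
  · left
    rw [iterate_add_apply,
      map_injOn_periodic_of_cubicDeriv_eq_zero φ (hit x hx k) (hit y hy i) hk0 h1, hback]
  · right
    have h2 : (cubic param)^[n] (-(cubic param)^[i] y) = -(cubic param)^[i] y := by
      rw [iterate_neg_of_odd (cubic_neg param), hit y hy i]
    rw [iterate_add_apply,
      map_injOn_periodic_of_cubicDeriv_eq_zero φ (hit x hx k) h2 hk0 (by rw [h1, map_neg]),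
      iterate_neg_of_odd (cubic_neg param), hback, neg_neg]

theorem isPeriodic_of_minimalPeriod {A : Type*} {f : A → A} {x : A} {n : ℕ}
    (h : minimalPeriod f x = n) : f^[n] x = x := by
  rw [← h, iterate_minimalPeriod]

/-- The multipliers of the `n`-cycles over `ParamRing`. -/
def paramMultipliers (n : ℕ) : Set ParamRing :=
  cubicDeriv n param '' {x | minimalPeriod (cubic param) x = n}

theorem ncard_paramMultipliers {n : ℕ} (hn : n ≠ 0) :
    ((paramMultipliers n).ncard : ℚ) = cubicLyndon n :=
  ncard_image_eq_cubicLyndon (cubic_neg param) eq_zero_of_neg_eq_self hn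
    (fun _ hd => ncard_periodic fun h => hn (by simpa [h] using hd))
    (fun _ hd => ncard_antiperiodic fun h => hn (by simpa [h] using hd)) _
    fun _ _ hx hy => cubicDeriv_eq_iff hn (isPeriodic_of_minimalPeriod hx)
      (isPeriodic_of_minimalPeriod hy)

theorem finite_paramMultipliers {n : ℕ} (hn : n ≠ 0) : (paramMultipliers n).Finite :=
  ((finite_periodic hn).subset fun _ hx => isPeriodic_of_minimalPeriod hx).image _

/-- Outside a finite set of parameters the specializations do not identify periodic points. -/
theorem exists_finite_injOn_periodic {n : ℕ} (hn : n ≠ 0) :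
    ∃ s : Set ℂ, s.Finite ∧ ∀ r ∉ s, ∀ φ : ParamRing →+* ℂ,
      (∀ a : ℂ[X], φ (algebraMap ℂ[X] ParamRing a) = a.eval r) →
      Set.InjOn φ {x : ParamRing | (cubic param)^[n] x = x} := by
  classical
  set F := (finite_periodic hn).toFinset with hF
  -- This product plays the role of a discriminant: collisions occur only where it specializes to
  -- `0`.
  have hδ : ∏ p ∈ F.offDiag, (p.1 - p.2) ≠ 0 := by
    rw [Finset.prod_ne_zero_iff]
    intro p hp
    exact sub_ne_zero.2 (Finset.mem_offDiag.1 hp).2.2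
  obtain ⟨s, hs, h⟩ := exists_finite_of_ne_zero hδ
  refine ⟨s, hs, fun r hr φ hφ x hx y hy hxy => ?_⟩
  by_contra hne
  refine h r hr φ hφ ?_
  rw [map_prod]
  refine Finset.prod_eq_zero (i := (x, y))
    (Finset.mem_offDiag.2 ⟨by simpa [hF] using hx, by simpa [hF] using hy, hne⟩) ?_
  rw [map_sub, hxy, sub_self]

/-- The defining polynomial is monic and splits over `ParamRing`, so its linear factors specialize;
this holds at every `r`. -/
theorem setOf_iterate_eq_image {φ : ParamRing →+* ℂ} {r : ℂ} (hφ : φ param = r) {n : ℕ}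
    (hn : n ≠ 0) (ε : ℤ) : {z : ℂ | (cubic r)^[n] z = ε * z} =
      φ '' {x : ParamRing | (cubic param)^[n] x = ε * x} := by
  have hm := (cubicPerPoly_monic_natDegree param hn (ε : ParamRing)).1
  have hmap : (cubicPerPoly param n (ε : ParamRing)).map φ = cubicPerPoly r n (ε : ℂ) := by
    rw [map_cubicPerPoly, hφ, map_intCast]
  have hroots := (splits_of_monic_paramRing hm).roots_map_of_ne_zero (hm.map φ).ne_zero
  rw [hmap] at hroots
  have hm' := (cubicPerPoly_monic_natDegree r hn (ε : ℂ)).1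
  ext z
  rw [Set.mem_ofPred_eq, ← isRoot_cubicPerPoly, ← mem_roots hm'.ne_zero, hroots,
    Multiset.mem_map]
  simp only [mem_roots hm.ne_zero, isRoot_cubicPerPoly, Set.mem_image, Set.mem_ofPred_eq]

theorem setOf_periodic_eq_image {φ : ParamRing →+* ℂ} {r : ℂ} (hφ : φ param = r) {n : ℕ}
    (hn : n ≠ 0) : {z : ℂ | (cubic r)^[n] z = z} =
      φ '' {x : ParamRing | (cubic param)^[n] x = x} := by
  simpa using setOf_iterate_eq_image hφ hn 1

theorem setOf_antiperiodic_eq_image {φ : ParamRing →+* ℂ} {r : ℂ} (hφ : φ param = r) {n : ℕ}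
    (hn : n ≠ 0) : {z : ℂ | (cubic r)^[n] z = -z} =
      φ '' {x : ParamRing | (cubic param)^[n] x = -x} := by
  simpa using setOf_iterate_eq_image hφ hn (-1)

/-! ### The minimal polynomial of the cycles -/

theorem evalEval_eq_map_aeval {φ : ParamRing →+* ℂ} {r : ℂ}
    (hφ : ∀ a : ℂ[X], φ (algebraMap ℂ[X] ParamRing a) = a.eval r) (Q : ℂ[X][Y]) (t : ParamRing) :
    Q.evalEval r (φ t) = φ (aeval t Q) := by
  have h : φ.comp (algebraMap ℂ[X] ParamRing) = evalRingHom r := RingHom.ext hφ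
  rw [aeval_def, hom_eval₂, h, eval₂_evalRingHom]

/-- A polynomial vanishes on the multipliers of all complex `n`-cycles if and only if it vanishes
on the multipliers of the `n`-cycles over `ParamRing`. -/
theorem vanishesOnCubicCycles_iff {n : ℕ} (hn : n ≠ 0) (Q : ℂ[X][Y]) :
    VanishesOnCubicCycles n Q ↔ ∀ t ∈ paramMultipliers n, aeval t Q = 0 := by
  constructor
  · rintro hQ _ ⟨x, hx, rfl⟩
    have hx' : minimalPeriod (cubic param) x = n := hx
    obtain ⟨s, hs, h⟩ := exists_finite_injOn_periodic hn
    -- At parameters without collisions the minimal period survives specialization, and vanishing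
    -- there suffices.
    refine eq_zero_of_specializations hs fun r hr => ?_
    obtain ⟨φ, hφ⟩ := exists_specialization r
    refine ⟨φ, hφ, ?_⟩
    have hper : ∀ d, (cubic r)^[d] (φ x) = φ ((cubic param)^[d] x) := fun d => by
      rw [map_cubic_iterate, map_param hφ]
    have hxn : (cubic param)^[n] x = x := isPeriodic_of_minimalPeriod hx'
    have hmin : minimalPeriod (cubicMap r) (φ x) = n := by
      rw [cubicMap_eq_cubic, ← hx', minimalPeriod_eq_minimalPeriod_iff]
      intro d
      rw [IsPeriodicPt, IsFixedPt, hper, IsPeriodicPt, IsFixedPt]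
      refine ⟨fun hd => h r hr φ hφ ?_ hxn hd, fun hd => by rw [hd]⟩
      change (cubic param)^[n] _ = _
      rw [← iterate_add_apply, add_comm, iterate_add_apply, hxn]
    rw [← evalEval_eq_map_aeval hφ, map_cubicDeriv, map_param hφ, ← cubicMultiplier_eq_cubicDeriv]
    exact hQ r (φ x) hmin
  · intro hQ r z hz
    rw [cubicMap_eq_cubic] at hz
    obtain ⟨φ, hφ⟩ := exists_specialization r
    have hzn : z ∈ {z : ℂ | (cubic r)^[n] z = z} := isPeriodic_of_minimalPeriod hz
    rw [setOf_periodic_eq_image (map_param hφ) hn] at hzn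
    obtain ⟨x, hx, rfl⟩ := hzn
    -- Specialization can only shorten the period, and the lift still satisfies `fⁿ(x) = x`.
    have hmin : minimalPeriod (cubic param) x = n := by
      refine Nat.dvd_antisymm (isPeriodicPt_iff_minimalPeriod_dvd.1 (hx : IsPeriodicPt _ n x)) ?_
      rw [← hz]
      refine isPeriodicPt_iff_minimalPeriod_dvd.1 ?_
      rw [IsPeriodicPt, IsFixedPt, ← map_param hφ, ← map_cubic_iterate, iterate_minimalPeriod]
    rw [cubicMultiplier_eq_cubicDeriv, ← map_param hφ, ← map_cubicDeriv, map_param hφ,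
      evalEval_eq_map_aeval hφ, hQ _ ⟨x, hmin, rfl⟩, map_zero]

/-- `P` is the product of `λ - t` over the distinct multipliers; every competitor has all of these
as roots. -/
theorem exists_isCubicCycleMinpoly {n : ℕ} (hn : n ≠ 0) :
    ∃ P : ℂ[X][Y], IsCubicCycleMinpoly n P ∧ P.natDegree = (paramMultipliers n).ncard := by
  set U := (finite_paramMultipliers hn).toFinset with hU
  have hUm : ∀ t, t ∈ U ↔ t ∈ paramMultipliers n := fun t => by simp [hU]
  obtain ⟨P, hm, hd, hP⟩ := exists_map_eq_prod_X_sub_C U fun σ t ht => by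
    obtain ⟨x, hx, rfl⟩ := (hUm t).1 ht
    have hit : ∀ d, (cubic param)^[d] (σ x) = σ ((cubic param)^[d] x) := fun d => by
      have := map_cubic_iterate (σ : ParamRing →+* ParamRing) d param x
      simpa [algEquiv_param] using this.symm
    refine (hUm _).2 ⟨σ x, ?_, ?_⟩
    · refine Eq.trans ?_ (hx : minimalPeriod (cubic param) x = n)
      refine minimalPeriod_eq_minimalPeriod_iff.2 fun d => ?_
      rw [IsPeriodicPt, IsFixedPt, hit, IsPeriodicPt, IsFixedPt, σ.injective.eq_iff]
    · have := map_cubicDeriv (σ : ParamRing →+* ParamRing) n param x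
      simpa [algEquiv_param] using this.symm
  have hcard : U.card = (paramMultipliers n).ncard :=
    (Set.ncard_eq_toFinset_card _ (finite_paramMultipliers hn)).symm
  refine ⟨P, ⟨hm, ?_, ?_⟩, by rw [hd, hcard]⟩
  · rw [vanishesOnCubicCycles_iff hn]
    intro t ht
    rw [aeval_def, ← eval_map, hP, eval_prod]
    exact Finset.prod_eq_zero ((hUm t).2 ht) (by simp)
  · intro Q hQ0 hQ
    rw [vanishesOnCubicCycles_iff hn] at hQ
    have hQ0' : Q.map (algebraMap ℂ[X] ParamRing) ≠ 0 :=
      (Polynomial.map_ne_zero_iff algebraMap_paramRing_injective).2 hQ0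
    rw [hd, ← natDegree_map_eq_of_injective algebraMap_paramRing_injective Q]
    refine card_le_degree_of_subset_roots fun t ht => ?_
    rw [mem_roots hQ0', IsRoot.def, eval_map, ← aeval_def]
    exact hQ t ((hUm t).1 ht)

/-- The difference of two monic candidates of equal degree vanishes on the cycles and has smaller
degree. -/
theorem IsCubicCycleMinpoly.eq {n : ℕ} {P Q : ℂ[X][Y]} (hP : IsCubicCycleMinpoly n P)
    (hQ : IsCubicCycleMinpoly n Q) : P = Q := by
  by_contra hne
  have hd : P.natDegree = Q.natDegree :=
    le_antisymm (hP.natDegree_le Q hQ.monic.ne_zero hQ.vanishes)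
      (hQ.natDegree_le P hP.monic.ne_zero hP.vanishes)
  have hlt : (P - Q).degree < P.degree :=
    degree_sub_lt_left (by rw [degree_eq_natDegree hP.monic.ne_zero,
      degree_eq_natDegree hQ.monic.ne_zero, hd]) hP.monic.ne_zero
      (by rw [hP.monic.leadingCoeff, hQ.monic.leadingCoeff])
  have hle := hP.natDegree_le (P - Q) (sub_ne_zero.2 hne) fun r x hx => by
    rw [evalEval_sub, hP.vanishes r x hx, hQ.vanishes r x hx, sub_zero]
  exact absurd (natDegree_lt_natDegree (sub_ne_zero.2 hne) hlt) (not_lt.2 hle)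

/-! ### The cycles up to sign -/

/-- The class `{C, -C}` of the cycle `C` of `x`. -/
def cubicClass (r x : ℂ) : Set (Set ℂ) :=
  {Set.range fun k : ℕ => (cubic r)^[k] x,
    (fun x : ℂ => -x) '' Set.range fun k : ℕ => (cubic r)^[k] x}

theorem cubicCycleClasses_eq_image (n : ℕ) (r : ℂ) :
    cubicCycleClasses n r = cubicClass r '' {x | minimalPeriod (cubic r) x = n} := by
  ext D
  constructor
  · rintro ⟨_, ⟨x, hx, rfl⟩, rfl⟩
    exact ⟨x, hx, rfl⟩
  · rintro ⟨x, hx, rfl⟩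
    exact ⟨_, ⟨x, hx, rfl⟩, rfl⟩

theorem range_iterate_iterate {A : Type*} {f : A → A} {x : A} {n : ℕ} (hn : n ≠ 0)
    (h : f^[n] x = x) (j : ℕ) :
    (Set.range fun k : ℕ => f^[k] (f^[j] x)) = Set.range fun k : ℕ => f^[k] x := by
  ext y
  constructor
  · rintro ⟨k, rfl⟩
    exact ⟨k + j, iterate_add_apply _ _ _ _⟩
  · rintro ⟨k, rfl⟩
    have hj : j ≤ j * n := Nat.le_mul_of_pos_right j (Nat.pos_of_ne_zero hn)
    refine ⟨k + (j * n - j), ?_⟩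
    have h1 : f^[j * n] x = x := (IsPeriodicPt.const_mul (h : IsPeriodicPt f n x) j)
    change f^[k + (j * n - j)] (f^[j] x) = f^[k] x
    rw [← iterate_add_apply, add_assoc, Nat.sub_add_cancel hj, iterate_add_apply, h1]

theorem range_iterate_neg (r x : ℂ) : (Set.range fun k : ℕ => (cubic r)^[k] (-x)) =
    (fun x : ℂ => -x) '' Set.range fun k : ℕ => (cubic r)^[k] x := by
  rw [← Set.range_comp]
  congr 1
  ext k
  exact iterate_neg_of_odd (cubic_neg r) k x

theorem cubicClass_eq_iff {n : ℕ} (hn : n ≠ 0) {r x y : ℂ} (hx : (cubic r)^[n] x = x) :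
    cubicClass r x = cubicClass r y ↔
      ∃ j, y = (cubic r)^[j] x ∨ y = -(cubic r)^[j] x := by
  constructor
  · intro h
    have h1 : (Set.range fun k : ℕ => (cubic r)^[k] y) ∈ cubicClass r x := by
      rw [h]; exact Set.mem_insert _ _
    have hy : y ∈ Set.range fun k : ℕ => (cubic r)^[k] y := ⟨0, rfl⟩
    rcases h1 with h1 | h1
    · rw [h1] at hy
      obtain ⟨j, hj⟩ := hy
      exact ⟨j, Or.inl hj.symm⟩
    · rw [Set.mem_singleton_iff.1 h1] at hy
      obtain ⟨_, ⟨j, rfl⟩, hj⟩ := hy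
      exact ⟨j, Or.inr hj.symm⟩
  · rintro ⟨j, rfl | rfl⟩
    · rw [cubicClass, cubicClass, range_iterate_iterate hn hx]
    · rw [cubicClass, cubicClass, range_iterate_neg, range_iterate_iterate hn hx, Set.image_image]
      simp only [neg_neg, Set.image_id']
      exact Set.pair_comm _ _

theorem finite_setOf_ncard_cubicCycleClasses_ne {n : ℕ} (hn : n ≠ 0) :
    {r : ℂ | ((cubicCycleClasses n r).ncard : ℚ) ≠ cubicLyndon n}.Finite := by
  obtain ⟨s, hs, h⟩ := exists_finite_injOn_periodic hn
  refine hs.subset fun r hr => ?_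
  by_contra hrs
  refine hr ?_
  obtain ⟨φ, hφ⟩ := exists_specialization r
  have hinj := h r hrs φ hφ
  rw [cubicCycleClasses_eq_image]
  refine ncard_image_eq_cubicLyndon (cubic_neg r) eq_zero_of_neg_eq_self hn (fun d hd => ?_)
    (fun d hd => ?_) _ fun x y hx _ => cubicClass_eq_iff hn (isPeriodic_of_minimalPeriod hx)
  · have hd0 : d ≠ 0 := fun h => hn (by simpa [h] using hd)
    rw [setOf_periodic_eq_image (map_param hφ) hd0, Set.InjOn.ncard_image, ncard_periodic hd0]
    exact hinj.mono fun x hx => IsPeriodicPt.trans_dvd (hx : IsPeriodicPt _ d x) hd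
  · have hd0 : d ≠ 0 := fun h => hn (by simpa [h] using hd)
    rw [setOf_antiperiodic_eq_image (map_param hφ) hd0, Set.InjOn.ncard_image,
      ncard_antiperiodic hd0]
    -- Antiperiodic points have period `2d`, a divisor of `n`, so the specialization is injective on
    -- them too.
    refine hinj.mono fun x hx => IsPeriodicPt.trans_dvd (m := 2 * d) ?_ hd
    exact isPeriodic_two_mul (Or.inr rfl) (by rw [neg_one_mul]; exact hx)

end

theorem theorem12 (n : ℕ) (hn : 1 ≤ n) :
    (∃! P : ℂ[X][Y], IsCubicCycleMinpoly n P) ∧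
    (∀ P : ℂ[X][Y], IsCubicCycleMinpoly n P → (P.natDegree : ℚ) = cubicLyndon n) ∧
    {r : ℂ | ((cubicCycleClasses n r).ncard : ℚ) ≠ cubicLyndon n}.Finite ∧
    ((evenTernaryNecklaces n).ncard : ℚ) = ∑ d ∈ n.divisors, cubicLyndon d := by
  have hn0 : n ≠ 0 := Nat.one_le_iff_ne_zero.1 hn
  obtain ⟨P, hP, hd⟩ := exists_isCubicCycleMinpoly hn0
  refine ⟨⟨P, hP, fun Q hQ => hQ.eq hP⟩, fun Q hQ => ?_,
    finite_setOf_ncard_cubicCycleClasses_ne hn0, ncard_evenTernaryNecklaces hn0⟩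
  rw [hQ.eq hP, hd, ncard_paramMultipliers hn0]
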